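/- **Model.** A network is a simple, connected, undirected graph $G=(V,E)$ with $n=|V|$ nodes, positive integer edge weights $W:E\to\mathbb{N}$ and distinct node identifiers in $\{0,1,2,\dots\}$; for a constant $c$, all identifiers are smaller than $n^c$ and all weights are at most $n^c$ (a node is identified with its identifier). $D$ denotes the hop-diameter of $G$. In the deterministic CONGEST model, computation proceeds in synchronous rounds; in each round every node performs arbitrary local computation and may send to each neighbour a message of $O(\log n)$ bits, which is received in the same round. Initially a node knows its own identifier, the identifiers of its neighbours, the weights of its incident edges, and its input. A terminated node has a fixed output and sends no further messages. For $v,w\in V$ let $\mathrm{wd}(v,w)$ be the minimum weight of a $v$–$w$ path, and let $h_{v,w}$ be the minimum number of edges among all $v$–$w$ paths of weight $\mathrm{wd}(v,w)$. **Problem.** Given $S\subseteq V$, $h,\sigma\in\mathbb{N}$ and $\varepsilon>0$, where each node is given $h,\sigma,\varepsilon$ and whether it belongs to $S$, *$(1+\varepsilon)$-approximate $(S,h,\sigma)$-estimation* is the following task: determine a function $\mathrm{wd}':V\times S\to\mathbb{N}_0\cup\{\infty\}$ with $\mathrm{wd}'(v,s)\ge \mathrm{wd}(v,s)$ for all $v\in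 V$, $s\in S$, and $\mathrm{wd}'(v,s)\le(1+\varepsilon)\,\mathrm{wd}(v,s)$ whenever $h_{v,s}\le h$; each node $v$ outputs the list $L_v$ of the first (up to) $\sigma$ elements, in ascending lexicographical order, of $\{(\mathrm{wd}'(v,s),s) : s\in S,\ \mathrm{wd}'(v,s)<\infty\}$. The sources occurring in $L_v$ are the sources *detected* by $v$. **Theorem.** For every constant $c$ there are a constant $\beta$, a single deterministic CONGEST algorithm, which uses messages of at most $\beta\log n$ bits, and a decoding function for routing tables, such that for every constant $\varepsilon_0$ there is a constant $K$ with the following property. For all networks as above, all $S\subseteq V$, all $h,\sigma\in\mathbb{N}_0$ and all $0<\varepsilon\le\varepsilon_0$: 1. The algorithm solves $(1+\varepsilon)$-approximate $(S,h,\sigma)$-estimation, with all nodes terminated after at most $K\left(\frac{h+\sigma}{\varepsilon^{2}}\log n+D\right)$ rounds. 2. Within the same rounds, every node also outputs a routing table of at most $K\sigma\log n$ bits, from which the decoding function obtains a next hop for each given destination identifier. For each $v\in V$ and each source $s$ detected by $v$, following the next hops for $s$ from $v$ leads to $s$ along a path of $G$ of weight at most $\mathrm{wd}'(v,s)$; in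 particular, if $h_{v,s}\le h$, this path has stretch at most $1+\varepsilon$, i.e. its weight is at most $(1+\varepsilon)\,\mathrm{wd}(v,s)$. 3. Whenever a node sends anything, it broadcasts, i.e. it sends the same message to all its neighbours, and each node does so in at most $K\frac{\sigma^{2}}{\varepsilon}\log n$ rounds. -/

import Mathlib

/-- A network with node set `V`: a simple connected undirected graph with positive integer edge
weights and pairwise distinct numerical node identifiers. -/
structure Network (V : Type) where
  graph : SimpleGraph V
  connected : graph.Connected
  weight : Sym2 V → ℕ
  weight_pos : ∀ e ∈ graph.edgeSet, 0 < weight e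
  ident : V → ℕ
  ident_injective : Function.Injective ident

namespace Network

variable {V : Type}

/-- With `n` the number of nodes: identifiers are below `n ^ c` (that is, they have at most
`c * log₂ n` bits) and edge weights are at most `n ^ c`. -/
def PolyBounded [Fintype V] (N : Network V) (c : ℕ) : Prop :=
  (∀ v, N.ident v < Fintype.card V ^ c) ∧
    ∀ e ∈ N.graph.edgeSet, N.weight e ≤ Fintype.card V ^ c

/-- The weight of a path: the sum of its edge weights. -/
def pathWeight (N : Network V) {u v : V} (p : N.graph.Walk u v) : ℕ :=
  (p.edges.map N.weight).sum

/-- The weighted distance: the least weight of a path. -/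
noncomputable def wdist (N : Network V) (u v : V) : ℕ :=
  sInf {w | ∃ p : N.graph.Walk u v, N.pathWeight p = w}

/-- The shortest path distance: the least number of hops among all paths of
minimum weight. -/
noncomputable def spHops (N : Network V) (u v : V) : ℕ :=
  sInf {k | ∃ p : N.graph.Walk u v, N.pathWeight p = N.wdist u v ∧ p.length = k}

/-- The hop-diameter. -/
noncomputable def hopDiam (N : Network V) : ℕ := N.graph.diam

/-- What a node knows of the network before the first round: its own identifier, and the
identifier of each neighbour together with the weight of the connecting edge. -/
structure View where
  ident : ℕ
  links : Set (ℕ × ℕ)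

def view (N : Network V) (v : V) : View where
  ident := N.ident v
  links := {p | ∃ u, N.graph.Adj v u ∧ p = (N.ident u, N.weight s(v, u))}

end Network

/-- A deterministic synchronous message passing algorithm, run by every node, with input values
in `I` and output values in `O`. Messages are bit strings; in a round, a node may send a
different message (or none) to each neighbour. A node has terminated as soon as `output` is
not `none`. -/
structure CongestAlgorithm (I O : Type) where
  State : Type
  /-- The state of a node before the first round, from its view and its input. -/
  init : Network.View → I → State
  output : State → Option O
  /-- The message for the neighbour with the given identifier. -/
  send : State → ℕ → Option (List Bool)
  /-- The next state, from the set of pairs (identifier of the sender, message) received. -/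
  receive : State → Set (ℕ × List Bool) → State

namespace CongestAlgorithm

variable {I O V : Type}

/-- The message that `u` addresses to `v` when the nodes are in the states `st`; terminated
nodes are silent. -/
def messageFrom (A : CongestAlgorithm I O) (N : Network V) (st : V → A.State) (u v : V) :
    Option (List Bool) :=
  if (A.output (st u)).isSome then none else A.send (st u) (N.ident v)

/-- The messages that `v` receives from its neighbours, tagged by their senders. -/
def inbox (A : CongestAlgorithm I O) (N : Network V) (st : V → A.State) (v : V) :
    Set (ℕ × List Bool) :=
  {q | ∃ u, N.graph.Adj u v ∧ q.1 = N.ident u ∧ A.messageFrom N st u v = some q.2}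

/-- The states of the nodes after `r` rounds; terminated nodes do not change any more. -/
def states (A : CongestAlgorithm I O) (N : Network V) (x : V → I) : ℕ → V → A.State
  | 0 => fun v => A.init (N.view v) (x v)
  | r + 1 => fun v =>
      if (A.output (A.states N x r v)).isSome then A.states N x r v
      else A.receive (A.states N x r v) (A.inbox N (A.states N x r) v)

/-- The message that `u` addresses to `v` in round `r` (the rounds are numbered `0, 1, …`). -/
def message (A : CongestAlgorithm I O) (N : Network V) (x : V → I) (r : ℕ) (u v : V) :
    Option (List Bool) :=
  A.messageFrom N (A.states N x r) u v

/-- After `T` rounds all nodes have terminated, node `v` with output `out v`. -/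
def TerminatesWith (A : CongestAlgorithm I O) (N : Network V) (x : V → I) (T : ℕ)
    (out : V → O) : Prop :=
  ∀ v, A.output (A.states N x T v) = some (out v)

/-- No message on any edge is ever longer than `B` bits. -/
def RespectsBandwidth (A : CongestAlgorithm I O) (N : Network V) (x : V → I) (B : ℝ) : Prop :=
  ∀ r u v, N.graph.Adj u v → ∀ m, A.message N x r u v = some m → (m.length : ℝ) ≤ B

/-- Whenever a node sends anything, it sends the same message to all its neighbours. -/
def BroadcastsOnly (A : CongestAlgorithm I O) (N : Network V) (x : V → I) : Prop :=
  ∀ r u v w, N.graph.Adj u v → N.graph.Adj u w → A.message N x r u v = A.message N x r u w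

/-- The number of rounds among the first `T` in which node `u` sends a message. -/
noncomputable def sendingRounds (A : CongestAlgorithm I O) (N : Network V) (x : V → I) (T : ℕ)
    (u : V) : ℕ :=
  {r | r < T ∧ ∃ v, N.graph.Adj u v ∧ A.message N x r u v ≠ none}.ncard

end CongestAlgorithm

/-- The input of a node in the partial distance estimation problem: the parameters `h`, `σ`
and `ε`, and whether the node is a source. -/
structure PDEInput where
  h : ℕ
  σ : ℕ
  ε : ℝ
  isSource : Prop

/-- The output of a node: its list of pairs (estimated distance, identifier of the source), and
its routing table, a bit string. -/
structure PDEOutput where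
  list : List (ℕ × ℕ)
  table : List Bool

namespace Network

variable {V : Type}

/-- The inputs of the nodes for the source set `S` and the parameters `h`, `σ`, `ε`. -/
def pdeInput (S : Finset V) (h σ : ℕ) (ε : ℝ) (v : V) : PDEInput where
  h := h
  σ := σ
  ε := ε
  isSource := v ∈ S

/-- `d` is a distance function for `(1 + ε)`-approximate `(S, h, σ)`-estimation. -/
def IsDistanceFunction (N : Network V) (S : Finset V) (h : ℕ) (ε : ℝ) (d : V → V → ℕ∞) : Prop :=
  (∀ v, ∀ s ∈ S, (N.wdist v s : ℕ∞) ≤ d v s) ∧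
    ∀ v, ∀ s ∈ S, N.spHops v s ≤ h →
      ∃ k : ℕ, d v s = k ∧ (k : ℝ) ≤ (1 + ε) * N.wdist v s

open scoped Classical in
/-- The sources at finite `d`-distance from `v`, as pairs (distance, identifier). -/
noncomputable def candidates (N : Network V) (S : Finset V) (d : V → V → ℕ∞) (v : V) :
    Finset (ℕ ×ₗ ℕ) :=
  (S.filter fun s => d v s ≠ ⊤).image fun s => toLex ((d v s).toNat, N.ident s)

/-- The first (up to) `σ` of these pairs in ascending lexicographical order. -/
noncomputable def topList (N : Network V) (S : Finset V) (d : V → V → ℕ∞) (σ : ℕ) (v : V) :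
    List (ℕ × ℕ) :=
  (((N.candidates S d v).sort (· ≤ ·)).take σ).map ofLex

/-- Every step of the path `p` is the one that `next` prescribes at the current node for the
destination with identifier `t`. -/
def Follows (N : Network V) (next : V → ℕ → ℕ) (t : ℕ) {u v : V} (p : N.graph.Walk u v) : Prop :=
  ∀ a ∈ p.darts, next a.fst t = N.ident a.snd

/-- Forwarding by `next` leads from each node `v` to each source `s` detected by `v` (given by its
identifier) along a path of weight at most the estimate `d v s`; the stretch is at most `1 + ε`
if some shortest weighted path from `v` to `s` has at most `h` hops. -/
def RoutesToDetected (N : Network V) (S : Finset V) (h σ : ℕ) (ε : ℝ) (d : V → V → ℕ∞)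
    (next : V → ℕ → ℕ) : Prop :=
  ∀ v, ∀ s ∈ S, ((d v s).toNat, N.ident s) ∈ N.topList S d σ v →
    ∃ p : N.graph.Walk v s, N.Follows next (N.ident s) p ∧
      (N.pathWeight p : ℕ∞) ≤ d v s ∧
      (N.spHops v s ≤ h → (N.pathWeight p : ℝ) ≤ (1 + ε) * N.wdist v s)

end Network

/-! One run of source detection treats all rounding scales at once. Values travel along walks from
the sources: an edge adds its weight rounded up to a multiple of `2 ^ i`, provided the new value is
at most `2 ^ i * H`, where `H = (2q + 1) h` and `q = ⌈1 / ε⌉`. Since rounding only goes up, no value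
falls below the distance. For a shortest path with at most `h` edges, take the least scale whose cap
accommodates it. Either this is scale 0 and nothing is rounded, or the next finer scale was too
small, and then the rounding error is at most a fraction `1 / q` of the weight (`exists_reach_le`).

A pair (value, source) is sent in the slot `delay` plus rank. The delay sums `min (x / 2 ^ i) H`
over the scales, so every extension increases it strictly (`Extends.delay_lt`), yet it stays below
`(m + 2) H` for values up to `2 ^ m * H` (`delay_le`). The rank does not drop when an entry is
passed on (`rank_entries_le`). Hence an entry of rank below `σ` is known before its slot comes
(`mem_candidates_of_slot_le`), and a node sends only final entries, each once
(`mem_and_rank_eq_of_early`).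

Nodes do not know `n`. They first flood logarithms of edge weights for `h` rounds; the resulting
local level caps a node's values and fixes its deadline. Each repeated broadcast in this phase
announces a larger level, so there are only `O(log n)` of them.

The next hop for a source is a neighbour that sent the pair. That neighbour has itself detected the
source, with an estimate smaller by at least the edge weight, so forwarding descends to the source
(`exists_route`). -/

namespace PDE

/-! ### Rounded weights and sending delays -/

/-- `w` rounded up to a multiple of `2 ^ i`. -/
def roundUp (i w : ℕ) : ℕ := 2 ^ i * ((w + (2 ^ i - 1)) / 2 ^ i)

theorem le_roundUp (i w : ℕ) : w ≤ roundUp i w := by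
  have h : 0 < 2 ^ i := by positivity
  have h1 := Nat.div_add_mod (w + (2 ^ i - 1)) (2 ^ i)
  have h2 := Nat.mod_lt (w + (2 ^ i - 1)) h
  unfold roundUp
  omega

theorem roundUp_lt (i w : ℕ) : roundUp i w < w + 2 ^ i := by
  have h : 0 < 2 ^ i := by positivity
  have h1 := Nat.div_add_mod (w + (2 ^ i - 1)) (2 ^ i)
  unfold roundUp
  omega

@[simp] theorem roundUp_zero (w : ℕ) : roundUp 0 w = w := by simp [roundUp]

theorem two_pow_le_roundUp {i w : ℕ} (hw : 0 < w) : 2 ^ i ≤ roundUp i w := by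
  have h : 0 < 2 ^ i := by positivity
  unfold roundUp
  exact Nat.le_mul_of_pos_right _ (Nat.div_pos (by omega) h)

/-- `y` is `x` plus the weight `w` rounded up at some scale that admits the value `y`:
at scale `i`, only values up to `2 ^ i * H` are admitted. -/
def Extends (H w x y : ℕ) : Prop := ∃ i, y = x + roundUp i w ∧ y ≤ 2 ^ i * H

theorem Extends.add_le {H w x y : ℕ} (h : Extends H w x y) : x + w ≤ y := by
  obtain ⟨i, rfl, -⟩ := h
  have := le_roundUp i w
  omega

/-- The delay after which the value `x` is sent. -/
def delay (H x : ℕ) : ℕ := ∑ i ∈ Finset.range x, min (x / 2 ^ i) H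

theorem delay_mono (H : ℕ) : Monotone (delay H) := fun x y hxy =>
  calc delay H x ≤ ∑ i ∈ Finset.range x, min (y / 2 ^ i) H :=
        Finset.sum_le_sum fun _ _ => min_le_min_right _ (Nat.div_le_div_right hxy)
    _ ≤ delay H y := Finset.sum_le_sum_of_subset (Finset.range_mono hxy)

/-- All summands are monotone, and the one at the scale used grows: the rounded weight is at least
`2 ^ i`, while the cap on `y` keeps `y / 2 ^ i` from being truncated at `H`. -/
theorem Extends.delay_lt {H w x y : ℕ} (h : Extends H w x y) (hw : 0 < w) :
    delay H x < delay H y := by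
  have hxy : x ≤ y := by have := h.add_le; omega
  obtain ⟨i, hy, hyH⟩ := h
  have h2 : 2 ^ i ≤ roundUp i w := two_pow_le_roundUp hw
  -- The sum runs only over scales below `y`, so the scale used must be among them.
  have hi : i < y := lt_of_lt_of_le Nat.lt_two_pow_self (by omega)
  have hpos : 0 < 2 ^ i := by positivity
  calc delay H x ≤ ∑ j ∈ Finset.range y, min (x / 2 ^ j) H :=
        Finset.sum_le_sum_of_subset (Finset.range_mono hxy)
    _ < delay H y := by
      refine Finset.sum_lt_sum (fun j _ => min_le_min_right _ (Nat.div_le_div_right hxy))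
        ⟨i, Finset.mem_range.2 hi, ?_⟩
      have h3 : x / 2 ^ i + 1 ≤ y / 2 ^ i := by
        rw [← Nat.add_div_right _ hpos]
        exact Nat.div_le_div_right (by omega)
      have h4 : y / 2 ^ i ≤ H := Nat.div_le_of_le_mul hyH
      omega

/-- Each of the `m` lowest scales contributes at most `H` by truncation; from scale `m` on, the
terms are dominated by `H / 2 ^ i`, a geometric series with sum at most `2 * H`. -/
theorem delay_le {H x m : ℕ} (hx : x ≤ 2 ^ m * H) : delay H x ≤ (m + 2) * H := by
  have h1 : delay H x ≤ ∑ i ∈ Finset.range (m + x), min (x / 2 ^ i) H :=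
    Finset.sum_le_sum_of_subset (Finset.range_mono (by omega))
  rw [Finset.sum_range_add] at h1
  have h2 : ∑ i ∈ Finset.range m, min (x / 2 ^ i) H ≤ m * H := by
    simpa using Finset.sum_le_card_nsmul (Finset.range m) (fun i => min (x / 2 ^ i) H) H
      (fun _ _ => min_le_right _ _)
  have h3 : ∑ i ∈ Finset.range x, min (x / 2 ^ (m + i)) H ≤ 2 * H := by
    calc _ ≤ ∑ i ∈ Finset.range x, H / 2 ^ i := by
          refine Finset.sum_le_sum fun i _ => (min_le_left _ _).trans ?_
          rw [pow_add, ← Nat.div_div_eq_div_mul]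
          exact Nat.div_le_div_right (Nat.div_le_of_le_mul hx)
      _ ≤ H * 2 / (2 - 1) := Nat.geom_sum_le le_rfl _ _
      _ = 2 * H := by simp [mul_comm]
  calc _ ≤ _ := h1
    _ ≤ m * H + 2 * H := add_le_add h2 h3
    _ = _ := by ring

/-! ### Codes for messages and routing tables -/

/-- A self-delimiting code for bit strings. -/
def delimit : List Bool → List Bool
  | [] => [false]
  | b :: l => true :: b :: delimit l

theorem length_delimit (l : List Bool) : (delimit l).length = 2 * l.length + 1 := by
  induction l with
  | nil => rfl
  | cons b l ih => simp only [delimit, List.length_cons, ih]; ring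

theorem delimit_append_inj {l l' r r' : List Bool} (h : delimit l ++ r = delimit l' ++ r') :
    l = l' ∧ r = r' := by
  induction l generalizing l' with
  | nil => cases l' <;> simp_all [delimit]
  | cons b l ih =>
    cases l' with
    | nil => simp [delimit] at h
    | cons b' l' =>
      simp only [delimit, List.cons_append, List.cons.injEq, true_and] at h
      obtain ⟨h1, h2⟩ := ih h.2
      simp [h.1, h1, h2]

/-- A self-delimiting code for pairs of natural numbers. -/
def encodePair (p : ℕ × ℕ) : List Bool := delimit p.1.bits ++ delimit p.2.bits

theorem length_encodePair (p : ℕ × ℕ) :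
    (encodePair p).length = 2 * p.1.size + 2 * p.2.size + 2 := by
  simp only [encodePair, List.length_append, length_delimit, Nat.size_eq_bits_len]
  ring

theorem bits_injective : Function.Injective Nat.bits := fun a b h => by
  have key : ∀ n : ℕ, n.bits.foldr (fun b m => Nat.bit b m) 0 = n := by
    intro n
    induction n using Nat.binaryRec' with
    | zero => simp
    | bit b n hn ih => rw [Nat.bits_append_bit _ _ hn, List.foldr_cons, ih]
  rw [← key a, h, key]

theorem encodePair_append_inj {p p' : ℕ × ℕ} {r r' : List Bool}
    (h : encodePair p ++ r = encodePair p' ++ r') : p = p' ∧ r = r' := by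
  simp only [encodePair, List.append_assoc] at h
  obtain ⟨h1, h2⟩ := delimit_append_inj h
  obtain ⟨h3, h4⟩ := delimit_append_inj h2
  exact ⟨Prod.ext (bits_injective h1) (bits_injective h3), h4⟩

theorem encodePair_injective : Function.Injective encodePair := fun p p' h =>
  (encodePair_append_inj (r := []) (r' := []) (by rw [h])).1

/-- The code of a routing table, given as a list of pairs (destination, next hop). -/
def encodeTable (L : List (ℕ × ℕ)) : List Bool := L.flatMap encodePair

/-- No end marker is needed: codes of pairs are nonempty and prefix-free, so the concatenation can
be parsed from the left. -/
theorem encodeTable_injective : Function.Injective encodeTable := by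
  intro L
  induction L with
  | nil =>
    intro L' h
    cases L' with
    | nil => rfl
    | cons p L' =>
      have := congrArg List.length h
      simp only [encodeTable, List.flatMap_nil, List.flatMap_cons, List.length_append,
        length_encodePair, List.length_nil] at this
      omega
  | cons p L ih =>
    intro L' h
    cases L' with
    | nil =>
      have := congrArg List.length h
      simp [encodeTable, length_encodePair] at this
    | cons p' L' =>
      simp only [encodeTable, List.flatMap_cons] at h
      obtain ⟨h1, h2⟩ := encodePair_append_inj h
      rw [h1, ih h2]

theorem length_encodeTable_le {L : List (ℕ × ℕ)} {B : ℕ}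
    (h : ∀ p ∈ L, (encodePair p).length ≤ B) : (encodeTable L).length ≤ L.length * B := by
  rw [encodeTable, List.length_flatMap]
  simpa using List.sum_le_card_nsmul (L.map fun p => (encodePair p).length) B (by
    intro k hk
    obtain ⟨p, hp, rfl⟩ := List.mem_map.1 hk
    exact h p hp)

/-- The next hop that the code of a routing table prescribes for a destination. -/
noncomputable def decodeTable (b : List Bool) (t : ℕ) : ℕ :=
  sInf {u | ∃ L, encodeTable L = b ∧ (t, u) ∈ L}

/-- The destinations in `L` need not be distinct; the decoder then returns the least of the listed
hops. -/
theorem decodeTable_encodeTable {L : List (ℕ × ℕ)} {t u : ℕ} (h : (t, u) ∈ L) :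
    (t, decodeTable (encodeTable L) t) ∈ L := by
  obtain ⟨L', h1, h2⟩ := Nat.sInf_mem (s := {u | ∃ L', encodeTable L' = encodeTable L ∧
    (t, u) ∈ L'}) ⟨u, L, rfl, h⟩
  rwa [encodeTable_injective h1] at h2

/-! ### Ranks and initial segments -/

/-- The number of elements of `C` below `a`. -/
noncomputable def rank {α : Type*} [LinearOrder α] (C : Set α) (a : α) : ℕ :=
  (C ∩ Set.Iio a).ncard

section rank

variable {α : Type*} [LinearOrder α]

theorem rank_lt_rank {C : Set α} (hC : C.Finite) {a b : α} (ha : a ∈ C) (hab : a < b) :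
    rank C a < rank C b :=
  Set.ncard_lt_ncard
    ⟨fun _ hx => ⟨hx.1, lt_trans hx.2 hab⟩, fun h => lt_irrefl a (h ⟨ha, hab⟩).2⟩
    (hC.subset Set.inter_subset_left)

theorem eq_of_rank_eq {C : Set α} (hC : C.Finite) {a b : α} (ha : a ∈ C) (hb : b ∈ C)
    (h : rank C a = rank C b) : a = b := by
  rcases lt_trichotomy a b with hab | hab | hab
  · exact absurd h (rank_lt_rank hC ha hab).ne
  · exact hab
  · exact absurd h (rank_lt_rank hC hb hab).ne'

theorem mem_take_iff_rank_lt (l : List α) (hl : l.SortedLT) (k : ℕ) (a : α) :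
    a ∈ l.take k ↔ a ∈ l ∧ rank {x | x ∈ l} a < k := by
  have key : ∀ i (hi : i < l.length), rank {x | x ∈ l} l[i] = i := by
    intro i hi
    have : ({x | x ∈ l} ∩ Set.Iio l[i]) = ↑((l.take i).toFinset) := by
      ext x
      simp only [Set.mem_inter_iff, Set.mem_ofPred_eq, Set.mem_Iio, List.coe_toFinset,
        List.mem_take_iff_getElem]
      constructor
      · rintro ⟨hx, hlt⟩
        obtain ⟨j, hj, rfl⟩ := List.getElem_of_mem hx
        exact ⟨j, by have := (hl.getElem_lt_getElem_iff).1 hlt; omega, rfl⟩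
      · rintro ⟨j, hj, rfl⟩
        exact ⟨List.getElem_mem _, (hl.getElem_lt_getElem_iff).2 (by omega)⟩
    rw [rank, this, Set.ncard_coe_finset, List.toFinset_card_of_nodup, List.length_take]
    · omega
    · exact (hl.nodup).sublist (List.take_sublist _ _)
  rw [List.mem_take_iff_getElem]
  constructor
  · rintro ⟨i, hi, rfl⟩
    exact ⟨List.getElem_mem _, by rw [key]; omega⟩
  · rintro ⟨ha, hk⟩
    obtain ⟨i, hi, rfl⟩ := List.getElem_of_mem ha
    rw [key] at hk
    exact ⟨i, by omega, rfl⟩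

open scoped Classical in
/-- The `k` first elements of a finite set, in ascending order. -/
noncomputable def first (C : Set α) (k : ℕ) : List α :=
  if h : C.Finite then (h.toFinset.sort (· ≤ ·)).take k else []

theorem mem_first {C : Set α} (hC : C.Finite) {k : ℕ} {a : α} :
    a ∈ first C k ↔ a ∈ C ∧ rank C a < k := by
  rw [first, dif_pos hC, mem_take_iff_rank_lt _ (Finset.sortedLT_sort _)]
  simp

theorem first_eq_first {C D : Set α} (hC : C.Finite) (hD : D.Finite) {k : ℕ}
    (h : ∀ a, (a ∈ C ∧ rank C a < k) ↔ (a ∈ D ∧ rank D a < k)) : first C k = first D k := by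
  have hs : ∀ {E : Set α} (_ : E.Finite), (first E k).SortedLT := by
    intro E hE
    rw [first, dif_pos hE]
    exact ((Finset.sortedLT_sort _).pairwise.sublist (List.take_sublist _ _)).sortedLT
  refine (hs hC).eq_of_mem_iff (hs hD) fun a => ?_
  rw [mem_first hC, mem_first hD, h]

theorem length_first_le (C : Set α) (k : ℕ) : (first C k).length ≤ k := by
  unfold first
  split_ifs <;> simp

theorem first_coe (F : Finset α) (k : ℕ) : first (F : Set α) k = (F.sort (· ≤ ·)).take k := by
  rw [first, dif_pos F.finite_toSet, Finset.finite_toSet_toFinset]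

end rank

/-! ### Agreement of partial knowledge with the final entries -/

section agreement

variable {C G : Set (ℕ ×ₗ ℕ)} {τ : ℕ → ℕ} {σ r : ℕ}

/-- A set `C` of upper bounds on the entries of `G` that contains the early entries of `G`
agrees with `G` on these entries. -/
theorem mem_and_rank_eq_of_early (hC : C.Finite)
    (hCu : ∀ a ∈ C, ∀ b ∈ C, (ofLex a).2 = (ofLex b).2 → a = b)
    (sound : ∀ a ∈ C, ∃ b ∈ G, (ofLex b).2 = (ofLex a).2 ∧ b ≤ a) (hτ : Monotone τ)
    (complete : ∀ a ∈ G, rank G a < σ → τ (ofLex a).1 + rank G a ≤ r → a ∈ C)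
    {a : ℕ ×ₗ ℕ} (ha : a ∈ C) (hσ : rank C a < σ) (hr : τ (ofLex a).1 + rank C a ≤ r) :
    a ∈ G ∧ rank G a = rank C a := by
  have hτ' : ∀ {x y : ℕ ×ₗ ℕ}, x ≤ y → τ (ofLex x).1 ≤ τ (ofLex y).1 := fun hxy =>
    hτ (Prod.Lex.monotone_fst _ _ hxy)
  have key : ∀ g, g ∈ G → g ≤ a → g ∈ C := by
    intro g
    induction g using WellFoundedLT.induction with
    | _ g ih =>
      intro hg hga
      -- By induction everything of `G` below `g` already lies in `C`, and below `a`. So `g` has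
      -- small enough rank and time for `complete` to apply.
      have hle : rank G g ≤ rank C a :=
        Set.ncard_le_ncard (fun x hx => ⟨ih x hx.2 hx.1 (hx.2.le.trans hga),
          lt_of_lt_of_le hx.2 hga⟩) (hC.subset Set.inter_subset_left)
      have := hτ' hga
      exact complete g hg (by omega) (by omega)
  have back : ∀ c ∈ C, c ≤ a → c ∈ G := by
    intro c hc hca
    obtain ⟨g, hg, h2, hgc⟩ := sound c hc
    rwa [← hCu g (key g hg (hgc.trans hca)) c hc h2]
  refine ⟨back a ha le_rfl, ?_⟩
  have : G ∩ Set.Iio a = C ∩ Set.Iio a := by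
    ext x
    exact ⟨fun hx => ⟨key x hx.1 hx.2.le, hx.2⟩, fun hx => ⟨back x hx.1 hx.2.le, hx.2⟩⟩
  rw [rank, rank, this]

/-- The converse transfer, with rank and time now measured in `G`. It shows that a due entry is
recognised as due from `C` alone. -/
theorem mem_and_rank_eq_of_early' (hG : G.Finite)
    (hCu : ∀ a ∈ C, ∀ b ∈ C, (ofLex a).2 = (ofLex b).2 → a = b)
    (sound : ∀ a ∈ C, ∃ b ∈ G, (ofLex b).2 = (ofLex a).2 ∧ b ≤ a) (hτ : Monotone τ)
    (complete : ∀ a ∈ G, rank G a < σ → τ (ofLex a).1 + rank G a ≤ r → a ∈ C)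
    {a : ℕ ×ₗ ℕ} (ha : a ∈ G) (hσ : rank G a < σ) (hr : τ (ofLex a).1 + rank G a ≤ r) :
    a ∈ C ∧ rank C a = rank G a := by
  have hτ' : ∀ {x y : ℕ ×ₗ ℕ}, x ≤ y → τ (ofLex x).1 ≤ τ (ofLex y).1 := fun hxy =>
    hτ (Prod.Lex.monotone_fst _ _ hxy)
  have key : ∀ g ∈ G, g < a → g ∈ C := by
    intro g hg hga
    have h1 := rank_lt_rank hG hg hga
    have := hτ' hga.le
    exact complete g hg (by omega) (by omega)
  refine ⟨complete a ha hσ hr, ?_⟩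
  have : C ∩ Set.Iio a = G ∩ Set.Iio a := by
    ext x
    refine ⟨fun hx => ⟨?_, hx.2⟩, fun hx => ⟨key x hx.1 hx.2, hx.2⟩⟩
    obtain ⟨g, hg, h2, hgx⟩ := sound x hx.1
    rwa [← hCu g (key g hg (lt_of_le_of_lt hgx hx.2)) x hx.1 h2]
  rw [rank, rank, this]

end agreement

end PDE

/-! ### Values along walks and estimates -/

namespace PDE

variable {V : Type}

/-- The values that are obtained at the nodes along walks from the source `s`, where the value at
`v` is at most `2 ^ lev v * H`. -/
inductive Reach (N : Network V) (H : ℕ) (lev : V → ℕ) (s : V) : V → ℕ → Prop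
  | source : Reach N H lev s s 0
  | step {u v : V} {x y : ℕ} (hx : Reach N H lev s u x) (huv : N.graph.Adj u v)
      (hxy : Extends H (N.weight s(v, u)) x y) (hy : y ≤ 2 ^ lev v * H) : Reach N H lev s v y

/-- `x` is the least value for the source `s` at `v`. -/
def IsEstimate (N : Network V) (H : ℕ) (lev : V → ℕ) (s v : V) (x : ℕ) : Prop :=
  IsLeast {y | Reach N H lev s v y} x

open scoped Classical in
/-- The least value for the source `s` at `v`, infinite if there is none. -/
noncomputable def estimate (N : Network V) (H : ℕ) (lev : V → ℕ) (v s : V) : ℕ∞ :=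
  if h : ∃ x, Reach N H lev s v x then (Nat.find h : ℕ∞) else ⊤

/-- The pairs (estimate, identifier of the source) at the node `v`. -/
def entries (N : Network V) (S : Finset V) (H : ℕ) (lev : V → ℕ) (v : V) : Set (ℕ ×ₗ ℕ) :=
  {a | ∃ s ∈ S, ∃ x, IsEstimate N H lev s v x ∧ a = toLex (x, N.ident s)}

variable {N : Network V} {S : Finset V} {H : ℕ} {lev : V → ℕ} {s u v : V} {x y : ℕ}

theorem weight_pos_of_adj (N : Network V) (h : N.graph.Adj u v) : 0 < N.weight s(v, u) :=
  N.weight_pos _ (by simpa using h.symm)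

theorem Reach.le_cap (h : Reach N H lev s v x) : x ≤ 2 ^ lev v * H := by
  cases h with
  | source => exact Nat.zero_le _
  | step _ _ _ hy => exact hy

theorem Reach.exists_walk (h : Reach N H lev s v x) :
    ∃ p : N.graph.Walk v s, N.pathWeight p ≤ x := by
  induction h with
  | source => exact ⟨.nil, by simp [Network.pathWeight]⟩
  | step _ huv hxy _ ih =>
    obtain ⟨p, hp⟩ := ih
    refine ⟨.cons huv.symm p, ?_⟩
    have := hxy.add_le
    simp only [Network.pathWeight, SimpleGraph.Walk.edges_cons, List.map_cons,
      List.sum_cons] at hp ⊢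
    omega

theorem wdist_le (N : Network V) (p : N.graph.Walk u v) : N.wdist u v ≤ N.pathWeight p :=
  Nat.sInf_le ⟨p, rfl⟩

theorem exists_wdist (N : Network V) (u v : V) :
    ∃ p : N.graph.Walk u v, N.pathWeight p = N.wdist u v := by
  obtain ⟨p⟩ := N.connected.preconnected u v
  exact Nat.sInf_mem (s := {w | ∃ p : N.graph.Walk u v, N.pathWeight p = w}) ⟨_, p, rfl⟩

theorem exists_spHops (N : Network V) (u v : V) :
    ∃ p : N.graph.Walk u v, N.pathWeight p = N.wdist u v ∧ p.length = N.spHops u v := by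
  obtain ⟨p, hp⟩ := exists_wdist N u v
  exact Nat.sInf_mem (s := {k | ∃ p : N.graph.Walk u v, N.pathWeight p = N.wdist u v ∧
    p.length = k}) ⟨_, p, hp, rfl⟩

theorem Reach.exists_isEstimate (h : Reach N H lev s v x) :
    ∃ y ≤ x, IsEstimate N H lev s v y := by
  classical
  exact ⟨Nat.find ⟨x, h⟩, Nat.find_le h, Nat.find_spec (⟨x, h⟩ : ∃ x, Reach N H lev s v x),
    fun _ hy => Nat.find_le hy⟩

theorem estimate_eq_coe_iff : estimate N H lev v s = x ↔ IsEstimate N H lev s v x := by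
  classical
  unfold estimate
  split_ifs with h
  · rw [Nat.cast_inj]
    constructor
    · rintro rfl
      exact ⟨Nat.find_spec h, fun _ hy => Nat.find_le hy⟩
    · intro hx
      exact le_antisymm (Nat.find_le hx.1) (hx.2 (Nat.find_spec h))
  · exact ⟨fun h' => absurd h' (ENat.top_ne_natCast x), fun h' => absurd ⟨x, h'.1⟩ h⟩

theorem IsEstimate.unique (hx : IsEstimate N H lev s v x) (hy : IsEstimate N H lev s v y) :
    x = y := IsLeast.unique hx hy

theorem isEstimate_self : IsEstimate N H lev v v 0 := ⟨.source, fun _ _ => Nat.zero_le _⟩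

theorem mem_entries {S : Finset V} {a : ℕ ×ₗ ℕ} :
    a ∈ entries N S H lev v ↔
      ∃ s ∈ S, IsEstimate N H lev s v (ofLex a).1 ∧ (ofLex a).2 = N.ident s := by
  constructor
  · rintro ⟨s, hs, x, hx, rfl⟩
    exact ⟨s, hs, hx, rfl⟩
  · rintro ⟨s, hs, hx, h⟩
    exact ⟨s, hs, _, hx, by rw [← h]; rfl⟩

theorem coe_candidates (v : V) :
    (N.candidates S (estimate N H lev) v : Set (ℕ ×ₗ ℕ)) = entries N S H lev v := by
  ext a
  simp only [Network.candidates, Finset.coe_image, Finset.coe_filter, Set.mem_image,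
    Set.mem_ofPred_eq]
  constructor
  · rintro ⟨s, ⟨hs, hne⟩, rfl⟩
    exact ⟨s, hs, _, estimate_eq_coe_iff.1 (ENat.natCast_toNat hne).symm, rfl⟩
  · rintro ⟨s, hs, x, hx, rfl⟩
    have := estimate_eq_coe_iff.2 hx
    exact ⟨s, ⟨hs, by rw [this]; exact ENat.natCast_ne_top x⟩, by rw [this]; rfl⟩

theorem finite_entries (N : Network V) (S : Finset V) (H : ℕ) (lev : V → ℕ) (v : V) :
    (entries N S H lev v).Finite := by
  rw [← coe_candidates]
  exact Finset.finite_toSet _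

theorem topList_estimate (σ : ℕ) (v : V) :
    N.topList S (estimate N H lev) σ v = (first (entries N S H lev v) σ).map ofLex := by
  rw [Network.topList, ← coe_candidates, first_coe]

theorem eq_of_mem_entries {a b : ℕ ×ₗ ℕ} (ha : a ∈ entries N S H lev v)
    (hb : b ∈ entries N S H lev v) (h : (ofLex a).2 = (ofLex b).2) : a = b := by
  obtain ⟨s, -, x, hx, rfl⟩ := ha
  obtain ⟨s', -, x', hx', rfl⟩ := hb
  obtain rfl := N.ident_injective h
  rw [hx.unique hx']

/-- A pair (estimate, source) at `v`, with an extension from `u` to `v` at which it arises. -/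
theorem IsEstimate.exists_parent (h : IsEstimate N H lev s v y) (hsv : s ≠ v) :
    ∃ u x, N.graph.Adj u v ∧ IsEstimate N H lev s u x ∧
      Extends H (N.weight s(v, u)) x y := by
  obtain ⟨h1, h2⟩ := h
  cases h1 with
  | source => exact absurd rfl hsv
  | @step u _ x _ hx huv hxy hy =>
    obtain ⟨x', hx', hest⟩ := hx.exists_isEstimate
    refine ⟨u, x', huv, hest, ?_⟩
    obtain ⟨i, rfl, hi⟩ := hxy
    have : Reach N H lev s v (x' + roundUp i (N.weight s(v, u))) :=
      .step hest.1 huv ⟨i, rfl, by omega⟩ (by omega)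
    have := h2 this
    -- A smaller value at `u`, extended at the same scale, would beat the minimum at `v`; so the
    -- value at `u` was already minimal.
    obtain rfl : x = x' := by omega
    exact ⟨i, rfl, hi⟩

/-- The rank of a source does not decrease when its entry is extended over an edge. -/
theorem rank_entries_le (huv : N.graph.Adj u v)
    (hxy : Extends H (N.weight s(v, u)) x y) (hy : IsEstimate N H lev s v y) :
    rank (entries N S H lev u) (toLex (x, N.ident s)) ≤
      rank (entries N S H lev v) (toLex (y, N.ident s)) := by
  have hcap := hy.1.le_cap
  obtain ⟨i, rfl, hi⟩ := hxy
  have key : ∀ a ∈ entries N S H lev u ∩ Set.Iio (toLex (x, N.ident s)),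
      ∃ b ∈ entries N S H lev v ∩ Set.Iio (toLex (x + roundUp i (N.weight s(v, u)), N.ident s)),
        (ofLex b).2 = (ofLex a).2 := by
    rintro _ ⟨⟨s', hs', x', hx', rfl⟩, hlt⟩
    rw [Set.mem_Iio, Prod.Lex.toLex_lt_toLex] at hlt
    -- A pair that precedes at `u` still precedes at `v` when extended over the same edge at the
    -- same scale: both values grow equally, and the smaller one satisfies the same caps. Sources
    -- are kept, so this is an injection.
    obtain ⟨y', hy', hest⟩ := (Reach.step hx'.1 huv (y := x' + roundUp i (N.weight s(v, u)))
      ⟨i, rfl, by omega⟩ (by omega)).exists_isEstimate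
    refine ⟨toLex (y', N.ident s'), ⟨⟨s', hs', y', hest, rfl⟩, ?_⟩, rfl⟩
    rw [Set.mem_Iio, Prod.Lex.toLex_lt_toLex]
    simp only at hlt ⊢
    omega
  choose! f hf hf2 using key
  refine Set.ncard_le_ncard_of_injOn f hf (fun a ha b hb hab => ?_)
    ((finite_entries N S H lev v).subset Set.inter_subset_left)
  exact eq_of_mem_entries ha.1 hb.1 (by rw [← hf2 a ha, ← hf2 b hb, hab])

/-! ### Approximation quality -/

/-- One fixed scale is used on all edges. The cap on the total rounded weight covers every partial
sum, and `i ≤ lev a` makes it respect the local caps. -/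
theorem reach_of_walk {i : ℕ} (p : N.graph.Walk v s) (hi : ∀ a ∈ p.support, i ≤ lev a)
    (hp : (p.edges.map fun e => roundUp i (N.weight e)).sum ≤ 2 ^ i * H) :
    ∃ x ≤ (p.edges.map fun e => roundUp i (N.weight e)).sum, Reach N H lev s v x := by
  induction p with
  | nil => exact ⟨0, Nat.zero_le _, .source⟩
  | @cons v u s h p ih =>
    simp only [SimpleGraph.Walk.edges_cons, List.map_cons, List.sum_cons,
      SimpleGraph.Walk.support_cons, List.mem_cons, forall_eq_or_imp] at hp hi ⊢
    obtain ⟨x, hx, hr⟩ := ih hi.2 (by omega)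
    refine ⟨x + roundUp i (N.weight s(v, u)), by omega, .step hr h.symm ⟨i, rfl, by omega⟩ ?_⟩
    calc _ ≤ 2 ^ i * H := by omega
      _ ≤ _ := Nat.mul_le_mul_right _ (Nat.pow_le_pow_right two_pos hi.1)

theorem sum_roundUp_add_length_le (i : ℕ) (p : N.graph.Walk u v) :
    (p.edges.map fun e => roundUp i (N.weight e)).sum + p.length ≤
      N.pathWeight p + p.length * 2 ^ i := by
  induction p with
  | nil => simp
  | @cons v u s h p ih =>
    simp only [Network.pathWeight, SimpleGraph.Walk.edges_cons, List.map_cons, List.sum_cons,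
      SimpleGraph.Walk.length_cons, add_mul, one_mul] at ih ⊢
    have := roundUp_lt i (N.weight s(v, u))
    omega

theorem pathWeight_le {W : ℕ} (p : N.graph.Walk u v) (hW : ∀ e ∈ p.edges, N.weight e ≤ W) :
    N.pathWeight p ≤ p.length * W := by
  have := List.sum_le_card_nsmul (p.edges.map N.weight) W (by
    intro k hk
    obtain ⟨e, he, rfl⟩ := List.mem_map.1 hk
    exact hW e he)
  simpa [Network.pathWeight] using this

/-- Along a walk of length at most `h` the weight is estimated up to a factor `1 + 1 / q`. -/
theorem exists_reach_le {q h : ℕ} (hq : 0 < q) (p : N.graph.Walk v s) (hlen : p.length ≤ h)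
    (hlev : ∀ a ∈ p.support, ∀ e ∈ p.edges, N.weight e ≤ 2 ^ lev a) :
    ∃ x, Reach N ((2 * q + 1) * h) lev s v x ∧ q * x ≤ (q + 1) * N.pathWeight p := by
  -- `P i` says that the weight plus the worst rounding error `h * (2 ^ i - 1)` fits under the cap
  -- of scale `i`, written without subtraction.
  let P : ℕ → Prop := fun i => N.pathWeight p + h * 2 ^ i ≤ 2 ^ i * ((2 * q + 1) * h) + h
  have hP : ∀ a ∈ p.support, P (lev a) := by
    intro a ha
    have h1 : N.pathWeight p ≤ h * 2 ^ lev a :=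
      (pathWeight_le p (hlev a ha)).trans (Nat.mul_le_mul_right _ hlen)
    have h2 : h * 2 ^ lev a ≤ q * (h * 2 ^ lev a) := Nat.le_mul_of_pos_left _ hq
    have : 2 ^ lev a * ((2 * q + 1) * h) = 2 * (q * (h * 2 ^ lev a)) + h * 2 ^ lev a := by ring
    simp only [P]
    omega
  have hex : ∃ i, P i := ⟨_, hP v p.start_mem_support⟩
  obtain ⟨i, hi, hmin⟩ : ∃ i, P i ∧ ∀ j < i, ¬ P j :=
    ⟨Nat.find hex, Nat.find_spec hex, fun j hj => Nat.find_min hex hj⟩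
  have hsum := sum_roundUp_add_length_le i p
  have hround : p.length * 2 ^ i + h ≤ h * 2 ^ i + p.length := by
    obtain ⟨k, rfl⟩ := Nat.exists_eq_add_of_le hlen
    have : k ≤ k * 2 ^ i := Nat.le_mul_of_pos_right _ (by positivity)
    rw [add_mul]
    omega
  -- `P` holds at the level of every node of the walk, so the least scale satisfying `P` is admitted
  -- at each of them.
  obtain ⟨x, hx, hr⟩ := reach_of_walk (H := (2 * q + 1) * h) p
    (fun a ha => le_of_not_gt fun hlt => hmin _ hlt (hP a ha)) (by simp only [P] at hi; omega)
  refine ⟨x, hr, ?_⟩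
  cases i with
  | zero =>
    have : x ≤ N.pathWeight p := by simpa [Network.pathWeight] using hx
    exact Nat.mul_le_mul (Nat.le_succ q) this
  | succ j =>
    -- Failure of `P` one scale below gives `q * (h * 2 ^ (j + 1)) < N.pathWeight p`: the rounding
    -- error is at most a `q`-th of the weight.
    have h1 := hmin j (Nat.lt_succ_self j)
    simp only [P, not_le] at h1
    have h2 : 2 ^ j * ((2 * q + 1) * h) = q * (h * 2 ^ (j + 1)) + h * 2 ^ j := by ring
    have h3 : x ≤ N.pathWeight p + h * 2 ^ (j + 1) := by omega
    calc q * x ≤ q * (N.pathWeight p + h * 2 ^ (j + 1)) := Nat.mul_le_mul_left _ h3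
      _ = q * N.pathWeight p + q * (h * 2 ^ (j + 1)) := by ring
      _ ≤ q * N.pathWeight p + N.pathWeight p := by omega
      _ = _ := by ring

/-- Small distances are not overestimated. -/
theorem IsEstimate.le_pathWeight (hx : IsEstimate N H lev s v x) (p : N.graph.Walk v s)
    (hp : N.pathWeight p ≤ H) : x ≤ N.pathWeight p := by
  have : (p.edges.map fun e => roundUp 0 (N.weight e)).sum = N.pathWeight p := by
    simp [Network.pathWeight]
  obtain ⟨y, hy, hr⟩ := reach_of_walk (lev := lev) (H := H) (i := 0) p
    (fun _ _ => Nat.zero_le _) (by omega)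
  exact (hx.2 hr).trans (this ▸ hy)

/-! ### Levels: local bounds on edge weights -/

/-- The greatest binary logarithm, rounded up, of the weight of an edge that is incident to a
node at distance at most `r`. -/
noncomputable def level (N : Network V) : ℕ → V → ℕ
  | 0, v => sSup ((fun p : ℕ × ℕ => Nat.clog 2 p.2) '' (N.view v).links)
  | r + 1, v => max (level N r v) (sSup (level N r '' {u | N.graph.Adj u v}))

theorem level_le_level_succ (N : Network V) (r : ℕ) (v : V) : level N r v ≤ level N (r + 1) v :=
  le_max_left _ _

theorem finite_links [Finite V] (N : Network V) (v : V) : (N.view v).links.Finite :=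
  (Set.finite_range fun u => (N.ident u, N.weight s(v, u))).subset
    fun _ ⟨u, _, h⟩ => ⟨u, h.symm⟩

theorem level_le [Finite V] {M : ℕ} (hM : ∀ e ∈ N.graph.edgeSet, N.weight e ≤ 2 ^ M) (r : ℕ)
    (v : V) : level N r v ≤ M := by
  induction r generalizing v with
  | zero =>
    refine csSup_le' ?_
    rintro _ ⟨_, ⟨u, hu, rfl⟩, rfl⟩
    exact Nat.clog_le_of_le_pow (hM _ hu)
  | succ r ih =>
    refine max_le (ih v) (csSup_le' ?_)
    rintro _ ⟨u, -, rfl⟩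
    exact ih u

theorem level_le_level_succ_of_adj [Finite V] (r : ℕ) (h : N.graph.Adj u v) :
    level N r u ≤ level N (r + 1) v :=
  le_max_of_le_right (le_csSup (Set.toFinite _).bddAbove ⟨u, h, rfl⟩)

theorem level_mono (N : Network V) (v : V) : Monotone fun r => level N r v :=
  monotone_nat_of_le_succ fun r => level_le_level_succ N r v

theorem level_zero_le [Finite V] (p : N.graph.Walk u v) : level N 0 v ≤ level N p.length u := by
  induction p with
  | nil => exact le_rfl
  | cons h p ih => exact ih.trans (level_le_level_succ_of_adj _ h.symm)

theorem weight_le_level_zero [Finite V] (h : N.graph.Adj v u) :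
    N.weight s(v, u) ≤ 2 ^ level N 0 v :=
  (Nat.le_pow_clog one_lt_two _).trans <| Nat.pow_le_pow_right two_pos <|
    le_csSup ((finite_links N v).image _).bddAbove ⟨_, ⟨u, h, rfl⟩, rfl⟩

theorem exists_walk_of_mem_support {a b : V} (p : N.graph.Walk u v) (ha : a ∈ p.support)
    (hb : b ∈ p.support) : ∃ q : N.graph.Walk a b, q.length ≤ p.length := by
  induction p with
  | nil =>
    simp only [SimpleGraph.Walk.support_nil, List.mem_singleton] at ha hb
    subst ha hb
    exact ⟨.nil, le_rfl⟩
  | @cons u w v h p ih =>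
    classical
    have key : ∀ {c}, c ∈ p.support →
        ∃ q : N.graph.Walk u c, q.length ≤ (SimpleGraph.Walk.cons h p).length := fun hc =>
      ⟨.cons h (p.takeUntil _ hc), by
        simpa using SimpleGraph.Walk.length_takeUntil_le_length p hc⟩
    rw [SimpleGraph.Walk.support_cons, List.mem_cons] at ha hb
    rcases ha with rfl | ha <;> rcases hb with rfl | hb
    · exact ⟨.nil, Nat.zero_le _⟩
    · exact key hb
    · obtain ⟨q, hq⟩ := key ha
      exact ⟨q.reverse, by simpa using hq⟩
    · obtain ⟨q, hq⟩ := ih ha hb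
      exact ⟨q, hq.trans (by simp)⟩

/-- Two nodes of a walk of at most `h` edges are joined by a walk of at most `h` edges, so `h`
rounds of flooding carry the level of an endpoint of `e` to `a`. -/
theorem weight_le_two_pow_level [Finite V] {h : ℕ} (p : N.graph.Walk u v) (hp : p.length ≤ h)
    {a : V} (ha : a ∈ p.support) {e : Sym2 V} (he : e ∈ p.edges) :
    N.weight e ≤ 2 ^ level N h a := by
  induction e using Sym2.ind with
  | _ b c =>
    obtain ⟨q, hq⟩ := exists_walk_of_mem_support p ha (p.fst_mem_support_of_mem_edges he)
    refine (weight_le_level_zero (p.adj_of_mem_edges he)).trans ?_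
    exact Nat.pow_le_pow_right two_pos
      ((level_zero_le q).trans (level_mono N a (hq.trans hp)))

/-! ### Parameters and size of the estimates -/

/-- The precision `q`, with `1 / q ≤ ε`. -/
noncomputable def precision (ε : ℝ) : ℕ := ⌈1 / ε⌉₊

/-- The greatest value in units of the scale. -/
noncomputable def horizon (h : ℕ) (ε : ℝ) : ℕ := (2 * precision ε + 1) * h

theorem isDistanceFunction_estimate [Finite V] (N : Network V) (S : Finset V) (h : ℕ) {ε : ℝ}
    (hε : 0 < ε) : N.IsDistanceFunction S h ε (estimate N (horizon h ε) (level N h)) := by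
  constructor
  · intro v s _
    rcases eq_or_ne (estimate N (horizon h ε) (level N h) v s) ⊤ with htop | htop
    · rw [htop]
      exact le_top
    · obtain ⟨x, hx⟩ := ENat.ne_top_iff_exists.1 htop
      obtain ⟨p, hp⟩ := (estimate_eq_coe_iff.1 hx.symm).1.exists_walk
      rw [← hx, Nat.cast_le]
      exact (wdist_le N p).trans hp
  · intro v s _ hh
    obtain ⟨p, hp, hlen⟩ := exists_spHops N v s
    have hq : 0 < precision ε := Nat.ceil_pos.2 (by positivity)
    obtain ⟨x, hr, hx⟩ := exists_reach_le (lev := level N h) hq p (hlen.trans_le hh)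
      fun a ha e he => weight_le_two_pow_level p (hlen.trans_le hh) ha he
    obtain ⟨y, hyx, hy⟩ := hr.exists_isEstimate
    refine ⟨y, estimate_eq_coe_iff.2 hy, ?_⟩
    rw [hp] at hx
    have h1 : (precision ε : ℝ) * y ≤ (precision ε + 1) * N.wdist v s := by
      exact_mod_cast (Nat.mul_le_mul_left _ hyx).trans hx
    have h2 : 1 / ε ≤ precision ε := Nat.le_ceil _
    have h3 : (1 : ℝ) ≤ precision ε * ε := by rwa [div_le_iff₀ hε] at h2
    have h4 : (0 : ℝ) < precision ε := by exact_mod_cast hq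
    refine le_of_mul_le_mul_left (h1.trans ?_) h4
    have : (0 : ℝ) ≤ N.wdist v s := Nat.cast_nonneg _
    nlinarith

theorem weight_le_two_pow [Fintype V] {c l : ℕ} (hl : Fintype.card V ≤ 2 ^ l)
    (hN : N.PolyBounded c) : ∀ e ∈ N.graph.edgeSet, N.weight e ≤ 2 ^ (c * l) := fun e he =>
  (hN.2 e he).trans (by rw [mul_comm, pow_mul]; exact Nat.pow_le_pow_left hl c)

/-- With `n ≤ 2 ^ l` nodes, estimates are polynomially bounded. -/
theorem IsEstimate.le_two_pow [Fintype V] {c l h : ℕ} (hl : Fintype.card V ≤ 2 ^ l)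
    (hN : N.PolyBounded c) (hx : IsEstimate N H (level N h) s v x) :
    x ≤ 2 ^ ((2 * c + 1) * l) := by
  classical
  have hW := weight_le_two_pow hl hN
  -- `h` and `1 / ε` are not bounded in terms of `n`, so the cap alone does not suffice. If `H` is
  -- large, an entire simple path is admissible at scale 0, and its weight bounds the estimate.
  rcases le_total H (2 ^ ((c + 1) * l)) with hH | hH
  · calc x ≤ 2 ^ level N h v * H := hx.1.le_cap
      _ ≤ 2 ^ (c * l) * 2 ^ ((c + 1) * l) :=
        Nat.mul_le_mul (Nat.pow_le_pow_right two_pos (level_le hW h v)) hH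
      _ = _ := by rw [← pow_add]; ring_nf
  · obtain ⟨p⟩ := N.connected.preconnected v s
    have h1 : N.pathWeight p.bypass ≤ 2 ^ ((c + 1) * l) :=
      calc _ ≤ p.bypass.length * 2 ^ (c * l) := pathWeight_le _ fun e he =>
            hW e (SimpleGraph.Walk.edges_subset_edgeSet _ he)
        _ ≤ 2 ^ l * 2 ^ (c * l) :=
          Nat.mul_le_mul_right _ (p.bypass_isPath.length_lt.le.trans hl)
        _ = _ := by rw [← pow_add]; ring_nf
    calc x ≤ _ := hx.le_pathWeight p.bypass (h1.trans hH)
      _ ≤ _ := h1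
      _ ≤ _ := Nat.pow_le_pow_right two_pos (Nat.mul_le_mul_right _ (by omega))

end PDE

/-! ### The algorithm -/

namespace PDE

/-- The state of a node. For the first `h` rounds, the nodes flood the greatest level of an edge
(`fresh` records whether it has just increased); then they exchange pairs (value, source), which
are stored together with their sender in `heard`. -/
structure NodeState where
  view : Network.View
  input : PDEInput
  round : ℕ
  level : ℕ
  fresh : Prop
  heard : Set (ℕ × ℕ × ℕ)

namespace NodeState

variable (st : NodeState)

/-- The unit in which the admissible values of the scales are measured. -/
noncomputable def horizon : ℕ := PDE.horizon st.input.h st.input.ε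

/-- The neighbours over which the pair `a` (value, source) has been obtained. -/
def hops (a : ℕ ×ₗ ℕ) : Set ℕ :=
  {u | ∃ w x, (u, w) ∈ st.view.links ∧ (u, x, (ofLex a).2) ∈ st.heard ∧
    Extends st.horizon w x (ofLex a).1}

/-- The pairs (value, source) obtained so far. -/
def candidates : Set (ℕ ×ₗ ℕ) :=
  {a | (st.input.isSource ∧ a = toLex (0, st.view.ident)) ∨
    ((st.hops a).Nonempty ∧ (ofLex a).1 ≤ 2 ^ st.level * st.horizon)}

/-- The pairs with the least value for their source. -/
def best : Set (ℕ ×ₗ ℕ) :=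
  {a ∈ st.candidates | ∀ b ∈ st.candidates, (ofLex b).2 = (ofLex a).2 → a ≤ b}

/-- The number of rounds after which the node terminates. -/
noncomputable def deadline : ℕ :=
  st.input.h + ((st.level + 2) * st.horizon + st.input.σ)

/-- The detected pairs (value, source). -/
noncomputable def detected : List (ℕ ×ₗ ℕ) := first st.best st.input.σ

open scoped Classical in
/-- The routing table: pairs (source, next hop). -/
noncomputable def table : List (ℕ × ℕ) :=
  st.detected.filterMap fun a =>
    if (st.hops a).Nonempty then some ((ofLex a).2, sInf (st.hops a)) else none

open scoped Classical in
/-- The output after termination. -/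
noncomputable def output : Option PDEOutput :=
  -- The first two cases must stop at once: with one node the round bound is zero because `log n =
  -- 0`, and with `σ = 0` no broadcast is permitted.
  if st.view.links = ∅ ∨ st.input.σ = 0 ∨ st.deadline ≤ st.round then
    some ⟨st.detected.map ofLex, encodeTable st.table⟩
  else none

open scoped Classical in
/-- The message that is broadcast. -/
noncomputable def message : Option (List Bool) :=
  if st.round < st.input.h then
    if st.fresh then some (List.replicate st.level true) else none
  else if ha : ∃ a ∈ st.best, rank st.best a < st.input.σ ∧
      st.input.h + (delay st.horizon (ofLex a).1 + rank st.best a) = st.round then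
    some (encodePair (ofLex ha.choose))
  else none

open scoped Classical in
/-- The state after a round in which the messages `M` are received. -/
noncomputable def receive (M : Set (ℕ × List Bool)) : NodeState :=
  if st.round < st.input.h then
    { st with
      round := st.round + 1
      level := max st.level (sSup ((fun q => q.2.length) '' M))
      fresh := st.level < max st.level (sSup ((fun q => q.2.length) '' M)) }
  else
    { st with
      round := st.round + 1
      heard := st.heard ∪ {p | (p.1, encodePair p.2) ∈ M} }

end NodeState

/-- The algorithm for partial distance estimation. -/
noncomputable abbrev algorithm : CongestAlgorithm PDEInput PDEOutput where
  State := NodeState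
  init view input :=
    { view := view
      input := input
      round := 0
      level := sSup ((fun p : ℕ × ℕ => Nat.clog 2 p.2) '' view.links)
      fresh := True
      heard := ∅ }
  output := NodeState.output
  send st _ := st.message
  receive := NodeState.receive

/-! ### Closed forms for the states -/

variable {V : Type} (N : Network V) (S : Finset V) (h σ : ℕ) (ε : ℝ)

/-- The states of the nodes after `r` rounds. -/
noncomputable def stateAt (r : ℕ) : V → NodeState :=
  algorithm.states N (Network.pdeInput S h σ ε) r

theorem stateAt_succ (r : ℕ) (v : V) : stateAt N S h σ ε (r + 1) v =
    if (stateAt N S h σ ε r v).output.isSome then stateAt N S h σ ε r v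
    else (stateAt N S h σ ε r v).receive (algorithm.inbox N (stateAt N S h σ ε r) v) := rfl

theorem messageFrom_eq {N : Network V} {st : V → NodeState} (u v : V) :
    algorithm.messageFrom N st u v =
      if (st u).output.isSome then none else (st u).message := rfl

/-- Whether the level of `v` has increased in the last of `r` rounds. -/
def freshAt : ℕ → V → Prop
  | 0, _ => True
  | r + 1, v => level N r v < level N (r + 1) v

/-- The state of `v` after `r ≤ h` rounds. -/
noncomputable def floodState (r : ℕ) (v : V) : NodeState where
  view := N.view v
  input := Network.pdeInput S h σ ε v
  round := r
  level := level N r v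
  fresh := freshAt N r v
  heard := ∅

/-- The pairs (estimate, source) of the node `v`. -/
abbrev entriesAt (v : V) : Set (ℕ ×ₗ ℕ) := entries N S (horizon h ε) (level N h) v

/-- The round after the flooding in which an entry of the node `v` is sent. -/
noncomputable def slot (v : V) (a : ℕ ×ₗ ℕ) : ℕ :=
  delay (horizon h ε) (ofLex a).1 + rank (entriesAt N S h ε v) a

/-- What `v` has heard `t` rounds after the flooding. -/
def heardAt (t : ℕ) (v : V) : Set (ℕ × ℕ × ℕ) :=
  {p | ∃ u, N.graph.Adj u v ∧ p.1 = N.ident u ∧ toLex p.2 ∈ entriesAt N S h ε u ∧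
    rank (entriesAt N S h ε u) (toLex p.2) < σ ∧ slot N S h ε u (toLex p.2) < t}

/-- The state of `v` after `h + t` rounds. -/
noncomputable def mainState (t : ℕ) (v : V) : NodeState where
  view := N.view v
  input := Network.pdeInput S h σ ε v
  round := h + t
  level := level N h v
  fresh := freshAt N h v
  heard := heardAt N S h σ ε t v

/-- The number of rounds after the flooding in which `v` is active. -/
noncomputable def activity (v : V) : ℕ := (level N h v + 2) * horizon h ε + σ

variable {N S h σ ε} {v : V} {t : ℕ} {a : ℕ ×ₗ ℕ}

/-- Values at `v` obey the cap of the level of `v`, so `delay_le` places every detected entry before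
the node's own deadline; stopping early loses no message. -/
theorem slot_lt_activity (ha : a ∈ entriesAt N S h ε v) (hr : rank (entriesAt N S h ε v) a < σ) :
    slot N S h ε v a < activity N h σ ε v := by
  obtain ⟨s, -, x, hx, rfl⟩ := ha
  exact add_lt_add_of_le_of_lt (delay_le hx.1.le_cap) hr

/-- Along the lexicographic order the delay is monotone and the rank strictly increasing, so one
message per round suffices. -/
theorem slot_injOn : Set.InjOn (slot N S h ε v) (entriesAt N S h ε v) := by
  intro a ha b hb hab
  have key : ∀ {a b}, a ∈ entriesAt N S h ε v → a < b → slot N S h ε v a < slot N S h ε v b :=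
    fun ha hlt => add_lt_add_of_le_of_lt
      (delay_mono _ (Prod.Lex.monotone_fst _ _ hlt.le)) (rank_lt_rank (finite_entries ..) ha hlt)
  rcases lt_trichotomy a b with hlt | heq | hlt
  · exact absurd hab (key ha hlt).ne
  · exact heq
  · exact absurd hab (key hb hlt).ne'

theorem mem_links {u : V} {w : ℕ} :
    (N.ident u, w) ∈ (N.view v).links ↔ N.graph.Adj v u ∧ w = N.weight s(v, u) := by
  constructor
  · rintro ⟨u', hu', heq⟩
    obtain ⟨h1, rfl⟩ := Prod.mk.inj heq
    obtain rfl := N.ident_injective h1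
    exact ⟨hu', rfl⟩
  · rintro ⟨h1, rfl⟩
    exact ⟨u, h1, rfl⟩

theorem mem_hops_mainState {k : ℕ} :
    k ∈ (mainState N S h σ ε t v).hops a ↔ ∃ u x, N.graph.Adj u v ∧ k = N.ident u ∧
      toLex (x, (ofLex a).2) ∈ entriesAt N S h ε u ∧
      rank (entriesAt N S h ε u) (toLex (x, (ofLex a).2)) < σ ∧
      slot N S h ε u (toLex (x, (ofLex a).2)) < t ∧
      Extends (horizon h ε) (N.weight s(v, u)) x (ofLex a).1 := by
  constructor
  · rintro ⟨w, x, hw, ⟨u, hu, rfl, h1, h2, h3⟩, hext⟩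
    obtain ⟨-, rfl⟩ := mem_links.1 hw
    exact ⟨u, x, hu, rfl, h1, h2, h3, hext⟩
  · rintro ⟨u, x, hu, rfl, h1, h2, h3, hext⟩
    exact ⟨_, x, mem_links.2 ⟨hu.symm, rfl⟩, ⟨u, hu, rfl, h1, h2, h3⟩, hext⟩

/-- Only final entries of neighbours are ever heard, so at any time a candidate is the value of an
actual walk and hence at least the estimate. -/
theorem exists_entry_le_of_mem_candidates (ha : a ∈ (mainState N S h σ ε t v).candidates) :
    ∃ b ∈ entriesAt N S h ε v, (ofLex b).2 = (ofLex a).2 ∧ b ≤ a := by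
  have key : ∀ s ∈ S, (ofLex a).2 = N.ident s →
      Reach N (horizon h ε) (level N h) s v (ofLex a).1 →
      ∃ b ∈ entriesAt N S h ε v, (ofLex b).2 = (ofLex a).2 ∧ b ≤ a := by
    intro s hs hid hr
    obtain ⟨y, hy, hest⟩ := hr.exists_isEstimate
    refine ⟨toLex (y, N.ident s), ⟨s, hs, y, hest, rfl⟩, hid.symm, ?_⟩
    rw [Prod.Lex.le_iff]
    rcases hy.lt_or_eq with h1 | h1
    · exact Or.inl h1
    · exact Or.inr ⟨h1, hid.ge⟩
  rcases ha with ⟨hs, rfl⟩ | ⟨⟨k, hk⟩, hcap⟩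
  · exact key v hs rfl .source
  · obtain ⟨u, x, hu, -, h1, -, -, hext⟩ := mem_hops_mainState.1 hk
    obtain ⟨s, hs, hest, hid⟩ := mem_entries.1 h1
    exact key s hs hid (.step hest.1 hu hext hcap)

/-- The causality argument: the parent entry has strictly smaller delay and no greater rank, so its
slot is strictly earlier and it has been heard in time. -/
theorem mem_candidates_of_slot_le (ha : a ∈ entriesAt N S h ε v)
    (hr : rank (entriesAt N S h ε v) a < σ) (ht : slot N S h ε v a ≤ t) :
    a ∈ (mainState N S h σ ε t v).candidates := by
  obtain ⟨s, hs, y, hest, rfl⟩ := ha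
  rcases eq_or_ne s v with rfl | hsv
  · obtain rfl := hest.unique isEstimate_self
    exact Or.inl ⟨hs, rfl⟩
  · obtain ⟨u, x, hu, hx, hext⟩ := hest.exists_parent hsv
    have hrank := rank_entries_le (S := S) hu hext hest
    have hdelay := hext.delay_lt (weight_pos_of_adj N hu)
    refine Or.inr ⟨⟨_, mem_hops_mainState.2 ⟨u, x, hu, rfl, ⟨s, hs, x, hx, rfl⟩,
      hrank.trans_lt hr, ?_, hext⟩⟩, hest.1.le_cap⟩
    exact lt_of_lt_of_le (add_lt_add_of_lt_of_le hdelay hrank) ht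

theorem mem_best_of_slot_le (ha : a ∈ entriesAt N S h ε v)
    (hr : rank (entriesAt N S h ε v) a < σ) (ht : slot N S h ε v a ≤ t) :
    a ∈ (mainState N S h σ ε t v).best := by
  refine ⟨mem_candidates_of_slot_le ha hr ht, fun b hb hba => ?_⟩
  obtain ⟨c, hc, hcb, hle⟩ := exists_entry_le_of_mem_candidates hb
  rwa [eq_of_mem_entries ha hc (hba.symm.trans hcb.symm)]

theorem NodeState.eq_of_mem_best {st : NodeState} {a b : ℕ ×ₗ ℕ} (ha : a ∈ st.best)
    (hb : b ∈ st.best) (hab : (ofLex a).2 = (ofLex b).2) : a = b :=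
  le_antisymm (ha.2 b hb.1 hab.symm) (hb.2 a ha.1 hab)

theorem finite_best : (mainState N S h σ ε t v).best.Finite := by
  refine Set.Finite.of_finite_image (f := fun a : ℕ ×ₗ ℕ => (ofLex a).2)
    (((finite_entries N S (horizon h ε) (level N h) v).image fun a => (ofLex a).2).subset ?_)
    fun a ha b hb hab => NodeState.eq_of_mem_best ha hb hab
  rintro _ ⟨a, ha, rfl⟩
  obtain ⟨b, hb, hba, -⟩ := exists_entry_le_of_mem_candidates ha.1
  exact ⟨b, hb, hba⟩

theorem mem_entries_of_mem_best (ha : a ∈ (mainState N S h σ ε t v).best)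
    (hr : rank (mainState N S h σ ε t v).best a < σ)
    (ht : delay (horizon h ε) (ofLex a).1 + rank (mainState N S h σ ε t v).best a ≤ t) :
    a ∈ entriesAt N S h ε v ∧
      rank (entriesAt N S h ε v) a = rank (mainState N S h σ ε t v).best a :=
  mem_and_rank_eq_of_early finite_best (fun _ ha _ hb => NodeState.eq_of_mem_best ha hb)
    (fun _ ha => exists_entry_le_of_mem_candidates ha.1) (delay_mono _)
    (fun _ => mem_best_of_slot_le) ha hr ht

theorem mem_best_and_rank_eq (ha : a ∈ entriesAt N S h ε v)
    (hr : rank (entriesAt N S h ε v) a < σ) (ht : slot N S h ε v a ≤ t) :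
    a ∈ (mainState N S h σ ε t v).best ∧
      rank (mainState N S h σ ε t v).best a = rank (entriesAt N S h ε v) a :=
  mem_and_rank_eq_of_early' (finite_entries ..)
    (fun _ ha _ hb => NodeState.eq_of_mem_best ha hb)
    (fun _ ha => exists_entry_le_of_mem_candidates ha.1) (delay_mono _)
    (fun _ => mem_best_of_slot_le) ha hr ht

/-- The node tests delay and rank within its current `best`; by the two agreement lemmas this test
singles out exactly the final entry whose slot is `t`. -/
theorem message_mainState (m : List Bool) :
    (mainState N S h σ ε t v).message = some m ↔ ∃ a ∈ entriesAt N S h ε v,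
      rank (entriesAt N S h ε v) a < σ ∧ slot N S h ε v a = t ∧ m = encodePair (ofLex a) := by
  have hlt : ¬ (mainState N S h σ ε t v).round < (mainState N S h σ ε t v).input.h := by
    simp [mainState, Network.pdeInput]
  have key : ∀ a, (a ∈ (mainState N S h σ ε t v).best ∧
      rank (mainState N S h σ ε t v).best a < (mainState N S h σ ε t v).input.σ ∧
      (mainState N S h σ ε t v).input.h + (delay (mainState N S h σ ε t v).horizon (ofLex a).1 +
        rank (mainState N S h σ ε t v).best a) = (mainState N S h σ ε t v).round) ↔
      (a ∈ entriesAt N S h ε v ∧ rank (entriesAt N S h ε v) a < σ ∧ slot N S h ε v a = t) := by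
    intro a
    constructor
    · rintro ⟨h1, h2, h3⟩
      have h3 := Nat.add_left_cancel h3
      obtain ⟨h4, h5⟩ := mem_entries_of_mem_best h1 h2 h3.le
      refine ⟨h4, h5.trans_lt h2, ?_⟩
      rw [slot, h5]
      exact h3
    · rintro ⟨h1, h2, h3⟩
      obtain ⟨h4, h5⟩ := mem_best_and_rank_eq h1 h2 h3.le
      refine ⟨h4, h5.trans_lt h2, congrArg (h + ·) ?_⟩
      rw [h5]
      exact h3
  rw [NodeState.message, if_neg hlt]
  split_ifs with hex
  · have hc := (key _).1 hex.choose_spec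
    constructor
    · intro heq
      exact ⟨_, hc.1, hc.2.1, hc.2.2, (Option.some.inj heq).symm⟩
    · rintro ⟨a, h1, -, h3, rfl⟩
      rw [slot_injOn hc.1 h1 (hc.2.2.trans h3.symm)]
  · refine iff_of_false (by simp) ?_
    rintro ⟨a, h1, h2, h3, -⟩
    exact absurd ⟨a, (key a).2 ⟨h1, h2, h3⟩⟩ hex

theorem deadline_mainState_le : (mainState N S h σ ε t v).deadline ≤
    (mainState N S h σ ε t v).round ↔ activity N h σ ε v ≤ t := by
  change h + activity N h σ ε v ≤ h + t ↔ _
  omega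

theorem output_mainState (hσ : σ ≠ 0) (hlinks : (N.view v).links ≠ ∅) :
    (mainState N S h σ ε t v).output = if activity N h σ ε v ≤ t then
      some ⟨(mainState N S h σ ε t v).detected.map ofLex,
        encodeTable (mainState N S h σ ε t v).table⟩ else none := by
  have : ((mainState N S h σ ε t v).view.links = ∅ ∨ (mainState N S h σ ε t v).input.σ = 0 ∨
      (mainState N S h σ ε t v).deadline ≤ (mainState N S h σ ε t v).round) ↔
      activity N h σ ε v ≤ t := by
    rw [deadline_mainState_le]
    simp [mainState, Network.pdeInput, hσ, hlinks]
  rw [NodeState.output]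
  exact if_congr this rfl rfl

theorem isSome_output_mainState (hσ : σ ≠ 0) (hlinks : (N.view v).links ≠ ∅) :
    (mainState N S h σ ε (min t (activity N h σ ε v)) v).output.isSome =
      decide (activity N h σ ε v ≤ t) := by
  rw [output_mainState hσ hlinks]
  split_ifs with hle
  · simpa using hle
  · simpa using hle

/-- After the flooding, nodes that have terminated have nothing left to send. -/
theorem messageFrom_mainState {st : V → NodeState} {u : V}
    (hu : st u = mainState N S h σ ε (min t (activity N h σ ε u)) u) (hσ : σ ≠ 0)
    (hlinks : (N.view u).links ≠ ∅) (v : V) (m : List Bool) :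
    algorithm.messageFrom N st u v = some m ↔ ∃ a ∈ entriesAt N S h ε u,
      rank (entriesAt N S h ε u) a < σ ∧ slot N S h ε u a = t ∧ m = encodePair (ofLex a) := by
  rw [messageFrom_eq, hu, isSome_output_mainState hσ hlinks]
  rcases lt_or_ge t (activity N h σ ε u) with hlt | hge
  · rw [if_neg (by simpa using hlt), min_eq_left hlt.le]
    exact message_mainState m
  · rw [if_pos (by simpa using hge)]
    refine iff_of_false (by simp) ?_
    rintro ⟨a, h1, h2, h3, -⟩
    have := slot_lt_activity h1 h2
    omega

theorem output_floodState {r : ℕ} (hr : r < h) (hσ : σ ≠ 0) (hlinks : (N.view v).links ≠ ∅) :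
    (floodState N S h σ ε r v).output = none := by
  rw [NodeState.output, if_neg]
  rintro (h1 | h1 | h1)
  · exact hlinks h1
  · exact hσ h1
  · change h + _ ≤ r at h1
    omega

theorem messageFrom_floodState {r : ℕ} {st : V → NodeState} {u : V}
    (hu : st u = floodState N S h σ ε r u) (hr : r < h) (hσ : σ ≠ 0)
    (hlinks : (N.view u).links ≠ ∅) (v : V) (m : List Bool) :
    algorithm.messageFrom N st u v = some m ↔
      freshAt N r u ∧ m = List.replicate (level N r u) true := by
  rw [messageFrom_eq, hu, output_floodState hr hσ hlinks]
  have hr' : (floodState N S h σ ε r u).round < (floodState N S h σ ε r u).input.h := hr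
  simp only [Option.isSome_none, Bool.false_eq_true, if_false, NodeState.message, hr', if_true]
  classical
  change (if freshAt N r u then some (List.replicate (level N r u) true) else none) = some m ↔ _
  split_ifs with hf <;> simp [hf, eq_comm]

/-- Neighbours whose level did not just increase can stay silent: `v` took their current level into
account one round earlier. -/
theorem level_succ_eq [Finite V] (r : ℕ) (v : V) :
    level N (r + 1) v =
      max (level N r v) (sSup (level N r '' {u | N.graph.Adj u v ∧ freshAt N r u})) := by
  refine le_antisymm (max_le (le_max_left _ _) (csSup_le' ?_))
    (max_le (le_max_left _ _) (csSup_le' ?_))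
  · rintro _ ⟨u, hu, rfl⟩
    by_cases hf : freshAt N r u
    · exact le_max_of_le_right (le_csSup (Set.toFinite _).bddAbove ⟨u, ⟨hu, hf⟩, rfl⟩)
    · cases r with
      | zero => exact absurd trivial hf
      | succ r => exact le_max_of_le_left ((not_lt.1 hf).trans (level_le_level_succ_of_adj r hu))
  · rintro _ ⟨u, hu, rfl⟩
    exact level_le_level_succ_of_adj r hu.1

theorem stateAt_eq_floodState [Finite V] (hσ : σ ≠ 0) (hlinks : ∀ v, (N.view v).links ≠ ∅)
    {r : ℕ} (hr : r ≤ h) (v : V) :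
    stateAt N S h σ ε r v = floodState N S h σ ε r v := by
  induction r generalizing v with
  | zero => rfl
  | succ r ih =>
    have ih := fun v => ih (by omega) v
    have hr' : r < h := hr
    have hout : (stateAt N S h σ ε r v).output = none := by
      rw [ih]; exact output_floodState hr' hσ (hlinks v)
    rw [stateAt_succ, if_neg (by rw [hout]; simp), ih]
    have himage : (fun q : ℕ × List Bool => q.2.length) ''
        algorithm.inbox N (stateAt N S h σ ε r) v =
        level N r '' {u | N.graph.Adj u v ∧ freshAt N r u} := by
      ext k
      constructor
      · rintro ⟨q, ⟨u, hu, -, hm⟩, rfl⟩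
        obtain ⟨hf, hq⟩ := (messageFrom_floodState (ih u) hr' hσ (hlinks u) v _).1 hm
        exact ⟨u, ⟨hu, hf⟩, by simp [hq]⟩
      · rintro ⟨u, ⟨hu, hf⟩, rfl⟩
        exact ⟨(N.ident u, List.replicate (level N r u) true), ⟨u, hu, rfl,
          (messageFrom_floodState (ih u) hr' hσ (hlinks u) v _).2 ⟨hf, rfl⟩⟩, by simp⟩
    have hlt : (floodState N S h σ ε r v).round < (floodState N S h σ ε r v).input.h := hr'
    rw [NodeState.receive, if_pos hlt, himage]
    have := level_succ_eq (N := N) r v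
    simp only [floodState, freshAt, this]

/-- The `min` expresses that a node freezes at its own deadline. Neighbours may still be active, but
by `messageFrom_mainState` the frozen node has nothing left to tell them. -/
theorem stateAt_eq_mainState [Finite V] (hσ : σ ≠ 0) (hlinks : ∀ v, (N.view v).links ≠ ∅) (t : ℕ) (v : V) :
    stateAt N S h σ ε (h + t) v =
      mainState N S h σ ε (min t (activity N h σ ε v)) v := by
  induction t generalizing v with
  | zero =>
    rw [add_zero, stateAt_eq_floodState hσ hlinks le_rfl]
    simp only [floodState, mainState, heardAt, zero_min, add_zero, not_lt_zero, and_false,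
      exists_false, Set.ofPred_false]
  | succ t ih =>
    have hout := isSome_output_mainState (S := S) (h := h) (ε := ε) (t := t) hσ (hlinks v)
    rw [← add_assoc, stateAt_succ, ih, hout]
    rcases lt_or_ge t (activity N h σ ε v) with hlt | hge
    · rw [if_neg (by simpa using hlt), min_eq_left hlt.le, min_eq_left hlt]
      have hround : ¬ (mainState N S h σ ε t v).round < (mainState N S h σ ε t v).input.h := by
        simp [mainState, Network.pdeInput]
      rw [NodeState.receive, if_neg hround]
      have hheard : heardAt N S h σ ε t v ∪ {p | (p.1, encodePair p.2) ∈
          algorithm.inbox N (stateAt N S h σ ε (h + t)) v} =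
          heardAt N S h σ ε (t + 1) v := by
        ext p
        constructor
        · rintro (⟨u, hu, h1, h2, h3, h4⟩ | ⟨u, hu, h1, hm⟩)
          · exact ⟨u, hu, h1, h2, h3, by omega⟩
          · obtain ⟨a, h2, h3, h4, h5⟩ := (messageFrom_mainState (ih u) hσ (hlinks u) v _).1 hm
            have h6 : p.2 = ofLex a := encodePair_injective h5
            refine ⟨u, hu, h1, ?_⟩
            rw [h6]
            exact ⟨h2, h3, by rw [toLex_ofLex]; omega⟩
        · rintro ⟨u, hu, h1, h2, h3, h4⟩
          rcases (Nat.lt_succ_iff.1 h4).lt_or_eq with h5 | h5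
          · exact Or.inl ⟨u, hu, h1, h2, h3, h5⟩
          · exact Or.inr ⟨u, hu, h1, (messageFrom_mainState (ih u) hσ (hlinks u) v _).2
              ⟨_, h2, h3, h5, rfl⟩⟩
      simp only [mainState] at hheard ⊢
      rw [hheard]
      rfl
    · rw [if_pos (by simpa using hge), min_eq_right hge, min_eq_right (by omega)]

end PDE

/-! ### Detected lists and routing -/

namespace PDE

variable {V : Type} {N : Network V} {S : Finset V} {h σ : ℕ} {ε : ℝ} {u v : V} {t : ℕ}
  {a : ℕ ×ₗ ℕ}

/-- On termination, a node has detected the entries of rank less than `σ`. -/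
theorem detected_mainState : (mainState N S h σ ε (activity N h σ ε v) v).detected =
    first (entriesAt N S h ε v) σ := by
  refine first_eq_first finite_best (finite_entries ..) fun a => ?_
  constructor
  · rintro ⟨h1, h2⟩
    -- The cap bounds the delay of any candidate, so at the deadline every pair of rank below `σ`
    -- counts as early.
    have hcap : (ofLex a).1 ≤ 2 ^ level N h v * horizon h ε := by
      rcases h1.1 with ⟨-, rfl⟩ | ⟨-, hcap⟩
      · exact Nat.zero_le _
      · exact hcap
    obtain ⟨h3, h4⟩ := mem_entries_of_mem_best h1 h2
      (add_lt_add_of_le_of_lt (delay_le hcap) h2).le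
    exact ⟨h3, h4.trans_lt h2⟩
  · rintro ⟨h1, h2⟩
    obtain ⟨h3, h4⟩ := mem_best_and_rank_eq h1 h2 (slot_lt_activity h1 h2).le
    exact ⟨h3, h4.trans_lt h2⟩

theorem NodeState.mem_table {st : NodeState} {s k : ℕ} :
    (s, k) ∈ st.table ↔
      ∃ a ∈ st.detected, (st.hops a).Nonempty ∧ (ofLex a).2 = s ∧ sInf (st.hops a) = k := by
  simp only [NodeState.table, List.mem_filterMap, Option.ite_none_right_eq_some,
    Option.some.injEq, Prod.mk.injEq]

theorem NodeState.length_table_le (st : NodeState) : st.table.length ≤ st.input.σ :=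
  (List.length_filterMap_le _ _).trans (length_first_le _ _)

/-- The final routing tables prescribe a hop over which the estimate has been obtained, to a node
that has detected the same source. -/
theorem exists_next_hop {s : V} {x : ℕ}
    (hmem : toLex (x, N.ident s) ∈ first (entriesAt N S h ε v) σ) (hsv : s ≠ v) :
    ∃ u y, N.graph.Adj v u ∧
      toLex (y, N.ident s) ∈ first (entriesAt N S h ε u) σ ∧ y + N.weight s(v, u) ≤ x ∧
      decodeTable (encodeTable (mainState N S h σ ε (activity N h σ ε v) v).table) (N.ident s) =
        N.ident u := by
  set st := mainState N S h σ ε (activity N h σ ε v) v with hst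
  have hne : (st.hops (toLex (x, N.ident s))).Nonempty := by
    rw [mem_first (finite_entries ..)] at hmem
    rcases mem_candidates_of_slot_le hmem.1 hmem.2 (slot_lt_activity hmem.1 hmem.2).le with
      ⟨-, h1⟩ | ⟨h1, -⟩
    · exact absurd (N.ident_injective (congrArg (fun a : ℕ ×ₗ ℕ => (ofLex a).2) h1)) hsv
    · exact h1
  have hdet : toLex (x, N.ident s) ∈ st.detected := by rwa [hst, detected_mainState]
  -- The decoded hop belongs to some detected pair `b` for the same source; a node has one entry per
  -- source, so `b` is the given pair.
  obtain ⟨b, hb, -, hbs, hbk⟩ := NodeState.mem_table.1 <| decodeTable_encodeTable <|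
    NodeState.mem_table.2 ⟨_, hdet, hne, rfl, rfl⟩
  rw [hst, detected_mainState, mem_first (finite_entries ..)] at hb hdet
  obtain rfl := eq_of_mem_entries hb.1 hdet.1 hbs
  obtain ⟨u, y, hu, hid, h1, h2, -, hext⟩ := mem_hops_mainState.1 (Nat.sInf_mem hne)
  exact ⟨u, y, hu.symm, (mem_first (finite_entries ..)).2 ⟨h1, h2⟩, hext.add_le,
    hbk.symm.trans hid⟩

/-- Each hop lowers the estimate by at least the positive weight of its edge, so the descent ends,
necessarily at `s`, and the weights telescope to at most `x`. -/
theorem exists_route {s : V} {x : ℕ}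
    (hmem : toLex (x, N.ident s) ∈ first (entriesAt N S h ε v) σ) :
    ∃ p : N.graph.Walk v s, N.Follows (fun v => decodeTable
      (encodeTable (mainState N S h σ ε (activity N h σ ε v) v).table)) (N.ident s) p ∧
      N.pathWeight p ≤ x := by
  induction x using Nat.strong_induction_on generalizing v with
  | _ x ih =>
    rcases eq_or_ne s v with rfl | hsv
    · exact ⟨.nil, by simp [Network.Follows], by simp [Network.pathWeight]⟩
    · obtain ⟨u, y, hvu, hmem', hle, hnext⟩ := exists_next_hop hmem hsv
      have := weight_pos_of_adj N hvu.symm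
      obtain ⟨p, hp, hpw⟩ := ih y (by omega) hmem'
      refine ⟨.cons hvu p, ?_, ?_⟩
      · intro a ha
        rw [SimpleGraph.Walk.darts_cons, List.mem_cons] at ha
        rcases ha with rfl | ha
        · exact hnext
        · exact hp a ha
      · simp only [Network.pathWeight, SimpleGraph.Walk.edges_cons, List.map_cons,
          List.sum_cons] at hpw ⊢
        omega

theorem routesToDetected_of_exists {d : V → V → ℕ∞} {next : V → ℕ → ℕ}
    (hd : N.IsDistanceFunction S h ε d)
    (hroute : ∀ v, ∀ s ∈ S, ((d v s).toNat, N.ident s) ∈ N.topList S d σ v →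
      ∃ p : N.graph.Walk v s, N.Follows next (N.ident s) p ∧ (N.pathWeight p : ℕ∞) ≤ d v s) :
    N.RoutesToDetected S h σ ε d next := by
  intro v s hs hmem
  obtain ⟨p, hp, hle⟩ := hroute v s hs hmem
  refine ⟨p, hp, hle, fun hh => ?_⟩
  obtain ⟨k, hk, hkle⟩ := hd.2 v s hs hh
  rw [hk, Nat.cast_le] at hle
  exact (Nat.cast_le.2 hle).trans hkle

theorem routesToDetected [Finite V] (hε : 0 < ε) :
    N.RoutesToDetected S h σ ε (estimate N (horizon h ε) (level N h)) (fun v => decodeTable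
      (encodeTable (mainState N S h σ ε (activity N h σ ε v) v).table)) := by
  refine routesToDetected_of_exists (isDistanceFunction_estimate N S h hε) fun v s hs hmem => ?_
  rw [topList_estimate, List.mem_map] at hmem
  obtain ⟨a, ha, heq⟩ := hmem
  obtain ⟨s', -, x, hest, rfl⟩ := ((mem_first (finite_entries ..)).1 ha).1
  obtain ⟨-, hid⟩ := Prod.mk.inj heq
  obtain rfl := N.ident_injective hid
  obtain ⟨p, hp, hle⟩ := exists_route ha
  refine ⟨p, hp, ?_⟩
  rw [estimate_eq_coe_iff.2 hest]
  exact Nat.cast_le.2 hle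

theorem broadcastsOnly (x : V → PDEInput) : algorithm.BroadcastsOnly N x :=
  fun _ _ _ _ _ _ => rfl

/-! ### Resource bounds for at least two nodes -/

section nontrivial

theorem links_ne_empty [Nontrivial V] (N : Network V) (v : V) : (N.view v).links ≠ ∅ := by
  obtain ⟨w, hw⟩ := exists_ne v
  obtain ⟨p⟩ := N.connected.preconnected v w
  cases p with
  | nil => exact absurd rfl hw
  | @cons _ u _ hu _ => exact Set.nonempty_iff_ne_empty.1 ⟨_, u, hu, rfl⟩

theorem message_of_lt [Finite V] [Nontrivial V] (hσ : σ ≠ 0) {r : ℕ} (hr : r < h) (u v : V)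
    (m : List Bool) :
    algorithm.message N (Network.pdeInput S h σ ε) r u v = some m ↔
      freshAt N r u ∧ m = List.replicate (level N r u) true :=
  messageFrom_floodState (stateAt_eq_floodState hσ (links_ne_empty N) hr.le u) hr hσ
    (links_ne_empty N u) v m

theorem message_add [Finite V] [Nontrivial V] (hσ : σ ≠ 0) (t : ℕ) (u v : V) (m : List Bool) :
    algorithm.message N (Network.pdeInput S h σ ε) (h + t) u v = some m ↔
      ∃ a ∈ entriesAt N S h ε u, rank (entriesAt N S h ε u) a < σ ∧ slot N S h ε u a = t ∧
        m = encodePair (ofLex a) :=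
  messageFrom_mainState (stateAt_eq_mainState hσ (links_ne_empty N) t u) hσ
    (links_ne_empty N u) v m

theorem size_ident_le [Fintype V] {c l : ℕ} (hl : Fintype.card V ≤ 2 ^ l)
    (hN : N.PolyBounded c) (v : V) : (N.ident v).size ≤ c * l :=
  Nat.size_le.2 <| (hN.1 v).trans_le (by rw [mul_comm, pow_mul]; exact Nat.pow_le_pow_left hl c)

/-- Levels are logarithms of weights, so unary flooding messages are affordable. The constant comes
from a pair: two bits for each of `(2 * c + 1) * l + 1` and `c * l` digits, and two delimiters. -/
theorem length_message_le [Fintype V] [Nontrivial V] {c l : ℕ} (hl : Fintype.card V ≤ 2 ^ l)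
    (hN : N.PolyBounded c) (hσ : σ ≠ 0) {r : ℕ} {m : List Bool}
    (hm : algorithm.message N (Network.pdeInput S h σ ε) r u v = some m) :
    m.length ≤ (6 * c + 2) * l + 4 := by
  rcases lt_or_ge r h with hr | hr
  · obtain ⟨-, rfl⟩ := (message_of_lt hσ hr u v m).1 hm
    have h1 := level_le (weight_le_two_pow hl hN) r u
    rw [List.length_replicate]
    nlinarith
  · obtain ⟨t, rfl⟩ := Nat.exists_eq_add_of_le hr
    obtain ⟨_, ⟨s, -, x, hest, rfl⟩, -, -, rfl⟩ := (message_add hσ t u v m).1 hm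
    have h1 : x.size ≤ (2 * c + 1) * l + 1 :=
      Nat.size_le.2 ((hest.le_two_pow hl hN).trans_lt (Nat.pow_lt_pow_succ one_lt_two))
    have h2 := size_ident_le hl hN s
    rw [length_encodePair]
    simp only [ofLex_toLex]
    nlinarith

/-- Broadcasts of the flooding are charged to distinct levels in `0, …, c * l`, later ones to
distinct ranks below `σ`. -/
theorem sendingRounds_le [Fintype V] [Nontrivial V] {c l : ℕ} (hl : Fintype.card V ≤ 2 ^ l)
    (hN : N.PolyBounded c) (hσ : σ ≠ 0) (T : ℕ) (u : V) :
    algorithm.sendingRounds N (Network.pdeInput S h σ ε) T u ≤ c * l + 1 + σ := by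
  let F : Set ℕ := {r | freshAt N r u}
  let E : Set (ℕ ×ₗ ℕ) := {a ∈ entriesAt N S h ε u | rank (entriesAt N S h ε u) a < σ}
  have hEfin : E.Finite := (finite_entries ..).subset fun _ ha => ha.1
  have hmaps : Set.MapsTo (fun r => level N r u) F (Set.Iio (c * l + 1)) := fun r _ =>
    Nat.lt_succ_of_le (level_le (weight_le_two_pow hl hN) r u)
  have hinj : Set.InjOn (fun r => level N r u) F := by
    have key : ∀ {r r' : ℕ}, freshAt N r' u → r < r' → level N r u < level N r' u := by
      intro r r' hr' hlt
      cases r' with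
      | zero => omega
      | succ k => exact (level_mono N u (Nat.lt_succ_iff.1 hlt)).trans_lt hr'
    intro r hr r' hr' heq
    rcases lt_trichotomy r r' with hlt | hlt | hlt
    · exact absurd heq (key hr' hlt).ne
    · exact hlt
    · exact absurd heq (key hr hlt).ne'
  have hFfin : F.Finite := Set.Finite.of_injOn hmaps hinj (Set.finite_Iio _)
  have hF : F.ncard ≤ c * l + 1 := by
    simpa using Set.ncard_le_ncard_of_injOn _ hmaps hinj (Set.finite_Iio _)
  have hE : E.ncard ≤ σ := by
    simpa using Set.ncard_le_ncard_of_injOn (t := Set.Iio σ) (rank (entriesAt N S h ε u))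
      (fun a ha => ha.2) (fun a ha b hb heq => eq_of_rank_eq (finite_entries ..) ha.1 hb.1 heq)
      (Set.finite_Iio _)
  calc _ ≤ (F ∪ (fun a => h + slot N S h ε u a) '' E).ncard := by
        refine Set.ncard_le_ncard ?_ (hFfin.union (hEfin.image _))
        rintro r ⟨-, v, -, hm⟩
        obtain ⟨m, hm⟩ := Option.ne_none_iff_exists'.1 hm
        rcases lt_or_ge r h with hr | hr
        · exact Or.inl ((message_of_lt hσ hr u v m).1 hm).1
        · obtain ⟨t, rfl⟩ := Nat.exists_eq_add_of_le hr
          obtain ⟨a, h1, h2, h3, -⟩ := (message_add hσ t u v m).1 hm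
          exact Or.inr ⟨a, ⟨h1, h2⟩, by simp only [h3]⟩
    _ ≤ F.ncard + E.ncard :=
        (Set.ncard_union_le _ _).trans (Nat.add_le_add_left (Set.ncard_image_le hEfin) _)
    _ ≤ _ := add_le_add hF hE

theorem terminatesWith [Fintype V] [Nontrivial V] {c l : ℕ} (hl : Fintype.card V ≤ 2 ^ l)
    (hN : N.PolyBounded c) (hσ : σ ≠ 0) :
    algorithm.TerminatesWith N (Network.pdeInput S h σ ε)
      (h + ((c * l + 2) * horizon h ε + σ)) fun v =>
      ⟨N.topList S (estimate N (horizon h ε) (level N h)) σ v,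
        encodeTable (mainState N S h σ ε (activity N h σ ε v) v).table⟩ := by
  intro v
  have hact : activity N h σ ε v ≤ (c * l + 2) * horizon h ε + σ :=
    Nat.add_le_add_right (Nat.mul_le_mul_right _
      (Nat.add_le_add_right (level_le (weight_le_two_pow hl hN) h v) 2)) σ
  have h1 : stateAt N S h σ ε (h + ((c * l + 2) * horizon h ε + σ)) v = _ :=
    stateAt_eq_mainState hσ (links_ne_empty N) _ v
  change (stateAt N S h σ ε (h + ((c * l + 2) * horizon h ε + σ)) v).output = _
  rw [h1, min_eq_right hact, output_mainState hσ (links_ne_empty N v), if_pos le_rfl,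
    detected_mainState]
  simp only [topList_estimate]

theorem length_table_le [Fintype V] {c l : ℕ} (hl : Fintype.card V ≤ 2 ^ l)
    (hN : N.PolyBounded c) (t : ℕ) (v : V) :
    (encodeTable (mainState N S h σ ε t v).table).length ≤ σ * (4 * (c * l) + 2) := by
  refine (length_encodeTable_le (B := 4 * (c * l) + 2) fun p hp => ?_).trans
    (Nat.mul_le_mul_right _ (NodeState.length_table_le _))
  obtain ⟨a, ha, hne, h1, h2⟩ := NodeState.mem_table.1 (show (p.1, p.2) ∈ _ from hp)
  obtain ⟨u, x, -, hk, -⟩ := mem_hops_mainState.1 (Nat.sInf_mem hne)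
  obtain ⟨b, hb, hba, -⟩ := exists_entry_le_of_mem_candidates ((mem_first finite_best).1 ha).1.1
  obtain ⟨s, -, y, -, rfl⟩ := hb
  have h3 := size_ident_le hl hN s
  have h4 := size_ident_le hl hN u
  rw [length_encodePair, ← h1, ← h2, hk, ← hba]
  simp only [ofLex_toLex]
  omega

end nontrivial

/-! ### Degenerate cases: one node, or nothing to detect -/

section trivial

/-- If a node has no neighbour or nothing has to be detected, it terminates at once. -/
theorem stateAt_of_trivial (ht : ∀ v, (N.view v).links = ∅ ∨ σ = 0) (r : ℕ) :
    stateAt N S h σ ε r = floodState N S h σ ε 0 ∧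
      ∀ v, (stateAt N S h σ ε r v).output =
        some ⟨(floodState N S h σ ε 0 v).detected.map ofLex,
          encodeTable (floodState N S h σ ε 0 v).table⟩ := by
  have hout : ∀ v, (floodState N S h σ ε 0 v).output =
      some ⟨(floodState N S h σ ε 0 v).detected.map ofLex,
        encodeTable (floodState N S h σ ε 0 v).table⟩ := by
    intro v
    rw [NodeState.output, if_pos]
    exact (ht v).imp_right Or.inl
  have hst : stateAt N S h σ ε r = floodState N S h σ ε 0 := by
    induction r with
    | zero => rfl
    | succ r ih =>
      funext v
      rw [stateAt_succ, ih, hout]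
      rfl
  exact ⟨hst, fun v => by rw [hst, hout]⟩

theorem message_of_trivial (ht : ∀ v, (N.view v).links = ∅ ∨ σ = 0) (r : ℕ) (u v : V) :
    algorithm.message N (Network.pdeInput S h σ ε) r u v = none := by
  change algorithm.messageFrom N (stateAt N S h σ ε r) u v = none
  rw [messageFrom_eq, (stateAt_of_trivial ht r).2]
  rfl

theorem hops_floodState (r : ℕ) (v : V) (a : ℕ ×ₗ ℕ) : (floodState N S h σ ε r v).hops a = ∅ :=
  Set.eq_empty_of_forall_notMem fun _ ⟨_, _, _, hx, _⟩ => hx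

theorem table_floodState (r : ℕ) (v : V) : (floodState N S h σ ε r v).table = [] := by
  simp [NodeState.table, hops_floodState]

theorem detected_floodState (ht : Subsingleton V ∨ σ = 0) (v : V) :
    (floodState N S h σ ε 0 v).detected = first (entriesAt N S h ε v) σ := by
  rcases ht with ht | rfl
  · have h1 : (floodState N S h σ ε 0 v).candidates = entriesAt N S h ε v := by
      ext a
      simp only [NodeState.candidates, hops_floodState, Set.not_nonempty_empty, false_and,
        or_false, Set.mem_ofPred_eq]
      constructor
      · rintro ⟨hs, rfl⟩
        exact ⟨v, hs, 0, isEstimate_self, rfl⟩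
      · rintro ⟨s, hs, x, hx, rfl⟩
        obtain rfl := Subsingleton.elim s v
        obtain rfl := hx.unique isEstimate_self
        exact ⟨hs, rfl⟩
    have h2 : (floodState N S h σ ε 0 v).best = entriesAt N S h ε v := by
      ext a
      rw [NodeState.best, h1]
      refine ⟨fun ha => ha.1, fun ha => ⟨ha, fun b hb hba => ?_⟩⟩
      rw [eq_of_mem_entries ha hb hba.symm]
    rw [NodeState.detected, h2]
    rfl
  · have key : ∀ C : Set (ℕ ×ₗ ℕ), first C 0 = [] := fun C =>
      List.eq_nil_of_length_eq_zero (Nat.le_zero.1 (length_first_le C 0))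
    rw [key]
    exact key _

theorem routesToDetected_of_trivial [Finite V] (ht : Subsingleton V ∨ σ = 0) (hε : 0 < ε)
    (next : V → ℕ → ℕ) :
    N.RoutesToDetected S h σ ε (estimate N (horizon h ε) (level N h)) next := by
  refine routesToDetected_of_exists (isDistanceFunction_estimate N S h hε) fun v s hs hmem => ?_
  rcases ht with ht | rfl
  · obtain rfl := Subsingleton.elim s v
    exact ⟨.nil, by simp [Network.Follows], by simp [Network.pathWeight]⟩
  · simp [Network.topList] at hmem

end trivial

/-! ### Passage to the real-valued bounds -/

section bounds

/-- Rounding up the logarithm costs less than 1, itself at most `log n / log 2`; and `2 / log 2 <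
3`. -/
theorem clog_le_three_mul_log {n : ℕ} (hn : 2 ≤ n) : (Nat.clog 2 n : ℝ) ≤ 3 * Real.log n := by
  have h1 : 0 < Nat.clog 2 n := Nat.clog_pos one_lt_two hn
  have h2 : 2 ^ (Nat.clog 2 n - 1) < n := Nat.pow_pred_clog_lt_self one_lt_two hn
  have hn' : (2 : ℝ) ≤ n := by exact_mod_cast hn
  have h3 : ((Nat.clog 2 n - 1 : ℕ) : ℝ) * Real.log 2 ≤ Real.log n := by
    rw [← Real.log_pow]
    exact Real.log_le_log (by positivity) (by exact_mod_cast h2.le)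
  rw [Nat.cast_sub h1] at h3
  have h4 : Real.log 2 ≤ Real.log n := Real.log_le_log two_pos hn'
  have h5 := Real.log_two_gt_d9
  have h6 : (1 : ℝ) ≤ Nat.clog 2 n := by exact_mod_cast h1
  push_cast at h3
  nlinarith

/-- Since `ε ≤ ε₀`, both `1 ≤ ε₀ ^ 2 / ε ^ 2` and `1 / ε ≤ ε₀ / ε ^ 2`; with `2q + 1 ≤ 2 / ε + 3`
this brings every term to the denominator `ε ^ 2`. -/
theorem rounds_le {c l h σ : ℕ} {ε ε₀ L : ℝ} (hε : 0 < ε) (hε₀ : ε ≤ ε₀) (hl : 1 ≤ l)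
    (hL : (l : ℝ) ≤ 3 * L) :
    ((h + ((c * l + 2) * horizon h ε + σ) : ℕ) : ℝ) ≤
      3 * (ε₀ ^ 2 + (c + 2) * (2 * ε₀ + 3 * ε₀ ^ 2)) * ((h + σ) / ε ^ 2 * L) := by
  have hl' : (1 : ℝ) ≤ l := by exact_mod_cast hl
  have hε₀' : 0 < ε₀ := hε.trans_le hε₀
  have hq : (precision ε : ℝ) ≤ 1 / ε + 1 := (Nat.ceil_lt_add_one (by positivity)).le
  have h1 : 1 ≤ ε₀ ^ 2 / ε ^ 2 := by
    rw [one_le_div (by positivity)]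
    exact pow_le_pow_left₀ hε.le hε₀ 2
  have h2 : 1 / ε ≤ ε₀ / ε ^ 2 := by
    rw [div_le_div_iff₀ hε (by positivity)]
    nlinarith
  have h3 : (2 * precision ε + 1 : ℝ) ≤ (2 * ε₀ + 3 * ε₀ ^ 2) / ε ^ 2 := by
    have : (2 * ε₀ + 3 * ε₀ ^ 2) / ε ^ 2 = 2 * (ε₀ / ε ^ 2) + 3 * (ε₀ ^ 2 / ε ^ 2) := by ring
    linarith
  have h4 : ((c * l + 2 : ℕ) : ℝ) ≤ (c + 2) * l := by
    push_cast
    linarith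
  have hh : (0 : ℝ) ≤ h := Nat.cast_nonneg h
  have hs : (0 : ℝ) ≤ σ := Nat.cast_nonneg σ
  have h5 : ((horizon h ε : ℕ) : ℝ) ≤ (2 * ε₀ + 3 * ε₀ ^ 2) / ε ^ 2 * h := by
    rw [horizon]
    push_cast
    exact mul_le_mul_of_nonneg_right h3 hh
  calc ((h + ((c * l + 2) * horizon h ε + σ) : ℕ) : ℝ)
      = ((c * l + 2 : ℕ) : ℝ) * (horizon h ε : ℕ) + 1 * (h + σ) := by push_cast; ring
    _ ≤ (c + 2) * l * ((2 * ε₀ + 3 * ε₀ ^ 2) / ε ^ 2 * (h + σ)) +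
        ε₀ ^ 2 / ε ^ 2 * l * (h + σ) := by
      refine add_le_add (mul_le_mul h4 (h5.trans ?_) (Nat.cast_nonneg _) (by positivity)) ?_
      · exact mul_le_mul_of_nonneg_left (by linarith) (by positivity)
      · exact mul_le_mul_of_nonneg_right (one_le_mul_of_one_le_of_one_le h1 hl') (by positivity)
    _ = (ε₀ ^ 2 + (c + 2) * (2 * ε₀ + 3 * ε₀ ^ 2)) * ((h + σ) / ε ^ 2) * l := by ring
    _ ≤ (ε₀ ^ 2 + (c + 2) * (2 * ε₀ + 3 * ε₀ ^ 2)) * ((h + σ) / ε ^ 2) * (3 * L) :=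
      mul_le_mul_of_nonneg_left hL (by positivity)
    _ = _ := by ring

theorem broadcasts_le {c l σ : ℕ} {ε ε₀ L : ℝ} (hε : 0 < ε) (hε₀ : ε ≤ ε₀) (hl : 1 ≤ l)
    (hL : (l : ℝ) ≤ 3 * L) (hσ : σ ≠ 0) :
    ((c * l + 1 + σ : ℕ) : ℝ) ≤ 3 * (c + 2) * ε₀ * (σ ^ 2 / ε * L) := by
  have h1 : c * l + 1 + σ ≤ (c + 2) * (σ ^ 2 * l) := by
    have h2 : 1 ≤ σ := Nat.one_le_iff_ne_zero.2 hσ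
    have h3 : σ ≤ σ ^ 2 * l := by nlinarith
    have h4 : l ≤ σ ^ 2 * l := Nat.le_mul_of_pos_left _ (by positivity)
    have h5 : c * l ≤ c * (σ ^ 2 * l) := Nat.mul_le_mul_left _ h4
    calc _ ≤ c * (σ ^ 2 * l) + σ ^ 2 * l + σ ^ 2 * l := by omega
      _ = _ := by ring
  have h2 : 1 ≤ ε₀ / ε := by rwa [one_le_div hε]
  calc ((c * l + 1 + σ : ℕ) : ℝ) ≤ ((c + 2) * (σ ^ 2 * l) : ℕ) := by exact_mod_cast h1
    _ = (c + 2) * σ ^ 2 * l := by push_cast; ring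
    _ ≤ (c + 2) * σ ^ 2 * (3 * L) := mul_le_mul_of_nonneg_left hL (by positivity)
    _ ≤ (c + 2) * σ ^ 2 * (3 * L) * (ε₀ / ε) :=
      le_mul_of_one_le_right (mul_nonneg (by positivity) (by linarith [Nat.cast_nonneg (α := ℝ) l]))
        h2
    _ = _ := by ring

end bounds

end PDE

/-! ### Assembly -/

theorem mainTheorem1 (c : ℕ) :
    ∃ (β : ℝ) (A : CongestAlgorithm PDEInput PDEOutput) (decode : List Bool → ℕ → ℕ),
      ∀ ε₀ : ℝ, ∃ K : ℝ,
        ∀ (V : Type) [Fintype V] (N : Network V), N.PolyBounded c →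
          ∀ (S : Finset V) (h σ : ℕ) (ε : ℝ), 0 < ε → ε ≤ ε₀ →
            ∃ (T : ℕ) (out : V → PDEOutput) (d : V → V → ℕ∞),
              -- termination and round complexity
              A.TerminatesWith N (Network.pdeInput S h σ ε) T out ∧
              (T : ℝ) ≤ K * ((h + σ) / ε ^ 2 * Real.log (Fintype.card V) + N.hopDiam) ∧
              A.RespectsBandwidth N (Network.pdeInput S h σ ε)
                (β * Real.log (Fintype.card V)) ∧
              -- correctness of the estimation
              N.IsDistanceFunction S h ε d ∧
              (∀ v, (out v).list = N.topList S d σ v) ∧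
              -- routing tables
              N.RoutesToDetected S h σ ε d (fun v => decode (out v).table) ∧
              (∀ v, ((out v).table.length : ℝ) ≤ K * (σ * Real.log (Fintype.card V))) ∧
              -- communication
              A.BroadcastsOnly N (Network.pdeInput S h σ ε) ∧
              ∀ v, (A.sendingRounds N (Network.pdeInput S h σ ε) T v : ℝ) ≤
                K * (σ ^ 2 / ε * Real.log (Fintype.card V)) := by
  -- `18 * c + 18` is `3 * (6 * c + 6)`, with the 3 from `clog_le_three_mul_log`. `K` adds the
  -- constants for rounds, tables and broadcasts.
  refine ⟨18 * c + 18, PDE.algorithm, PDE.decodeTable, fun ε₀ =>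
    ⟨3 * (ε₀ ^ 2 + (c + 2) * (2 * ε₀ + 3 * ε₀ ^ 2)) + (12 * c + 6) + 3 * (c + 2) * ε₀, ?_⟩⟩
  intro V _ N hN S h σ ε hε hε₀
  have hε₀' : 0 < ε₀ := hε.trans_le hε₀
  have hlog : 0 ≤ Real.log (Fintype.card V) := Real.log_natCast_nonneg _
  set K₁ : ℝ := 3 * (ε₀ ^ 2 + (c + 2) * (2 * ε₀ + 3 * ε₀ ^ 2)) with hK₁
  set K₂ : ℝ := 12 * c + 6 with hK₂
  set K₃ : ℝ := 3 * (c + 2) * ε₀ with hK₃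
  have hp₁ : 0 ≤ K₁ := by positivity
  have hp₂ : 0 ≤ K₂ := by positivity
  have hp₃ : 0 ≤ K₃ := by positivity
  have hd := PDE.isDistanceFunction_estimate N S h hε
  by_cases ht : Subsingleton V ∨ σ = 0
  · have ht' : ∀ v, (N.view v).links = ∅ ∨ σ = 0 := fun v => ht.imp_left fun hV =>
      Set.eq_empty_of_forall_notMem fun _ ⟨u, hu, _⟩ => hu.ne (hV.elim _ _)
    refine ⟨0, fun v => ⟨N.topList S (PDE.estimate N (PDE.horizon h ε) (PDE.level N h)) σ v, []⟩,
      _, ?_, ?_, ?_, hd, fun _ => rfl, PDE.routesToDetected_of_trivial ht hε _, ?_,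
      PDE.broadcastsOnly _, ?_⟩
    · intro v
      have := (PDE.stateAt_of_trivial (S := S) (h := h) (ε := ε) ht' 0).2 v
      rw [PDE.detected_floodState ht, PDE.table_floodState, ← PDE.topList_estimate] at this
      exact this
    · rw [Nat.cast_zero]
      positivity
    · intro r u v _ m hm
      rw [PDE.message_of_trivial ht'] at hm
      exact nomatch hm
    · intro v
      simp only [List.length_nil, Nat.cast_zero]
      positivity
    · intro v
      simp only [CongestAlgorithm.sendingRounds, not_lt_zero, false_and, Set.ofPred_false,
        Set.ncard_empty, Nat.cast_zero]
      positivity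
  · rw [not_or, not_subsingleton_iff_nontrivial] at ht
    obtain ⟨hV, hσ⟩ := ht
    have hn : 2 ≤ Fintype.card V := Fintype.one_lt_card
    have hl : Fintype.card V ≤ 2 ^ Nat.clog 2 (Fintype.card V) := Nat.le_pow_clog one_lt_two _
    have hL := PDE.clog_le_three_mul_log hn
    have hl1 : 1 ≤ Nat.clog 2 (Fintype.card V) := Nat.clog_pos one_lt_two hn
    have hl1' : (1 : ℝ) ≤ Nat.clog 2 (Fintype.card V) := by exact_mod_cast hl1
    refine ⟨_, _, _, PDE.terminatesWith hl hN hσ, ?_, ?_, hd, fun _ => rfl,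
      PDE.routesToDetected hε, ?_, PDE.broadcastsOnly _, ?_⟩
    · refine (PDE.rounds_le hε hε₀ hl1 hL).trans (mul_le_mul (by linarith) ?_ (by positivity)
        (by positivity))
      -- Deadlines are local, so the first summand alone bounds the rounds; the hop-diameter is only
      -- added on.
      exact le_add_of_nonneg_right (Nat.cast_nonneg _)
    · intro r u v _ m hm
      calc (m.length : ℝ) ≤ ((6 * c + 2) * Nat.clog 2 (Fintype.card V) + 4 : ℕ) :=
            Nat.cast_le.2 (PDE.length_message_le hl hN hσ hm)
        _ ≤ (6 * c + 6) * Nat.clog 2 (Fintype.card V) := by push_cast; linarith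
        _ ≤ (6 * c + 6) * (3 * Real.log (Fintype.card V)) :=
          mul_le_mul_of_nonneg_left hL (by positivity)
        _ = _ := by ring
    · intro v
      calc _ ≤ ((σ * (4 * (c * Nat.clog 2 (Fintype.card V)) + 2) : ℕ) : ℝ) :=
            Nat.cast_le.2 (PDE.length_table_le hl hN _ v)
        _ = σ * (4 * c * Nat.clog 2 (Fintype.card V) + 2) := by push_cast; ring
        _ ≤ σ * ((4 * c + 2) * Nat.clog 2 (Fintype.card V)) :=
          mul_le_mul_of_nonneg_left (by linarith) (by positivity)
        _ ≤ σ * ((4 * c + 2) * (3 * Real.log (Fintype.card V))) := by gcongr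
        _ = K₂ * (σ * Real.log (Fintype.card V)) := by rw [hK₂]; ring
        _ ≤ _ := mul_le_mul_of_nonneg_right (by linarith) (by positivity)
    · intro v
      calc _ ≤ ((c * Nat.clog 2 (Fintype.card V) + 1 + σ : ℕ) : ℝ) :=
            Nat.cast_le.2 (PDE.sendingRounds_le hl hN hσ _ v)
        _ ≤ _ := PDE.broadcasts_le hε hε₀ hl1 hL hσ
        _ ≤ _ := mul_le_mul_of_nonneg_right (by linarith) (by positivity)
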